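/- Let $k$ be a field of characteristic $0$, let $V$ be a finite-dimensional $k$-vector space, and let $X\subseteq V$ be a conical subscheme, given by a homogeneous ideal $I_X\subseteq \mathrm{Sym}(V)$ (here $\mathrm{Sym}(V)$ denotes the ring of polynomial functions, with $V$ in degree $1$). Put $B=\mathrm{Sym}(V)/I_X=\bigoplus_{d\ge 0}B_d$. For $d,m\ge 0$ let $I(1)_{d,m}\subseteq \mathrm{Sym}^m(B_d)$ be the kernel of the multiplication map $\mathrm{Sym}^m(B_d)\to B_{dm}$, and for $r\ge 2$ let $I(r)_{d,m}$ be the kernel of the comultiplication map $$\mathrm{Sym}^m(B_d)\to\bigoplus_{i=0}^m \mathrm{Sym}^i(B_d)/I(1)_{d,i}\otimes_k \mathrm{Sym}^{m-i}(B_d)/I(r-1)_{d,m-i}.$$ For each $d$ and $r\ge 1$ the sum $\bigoplus_m I(r)_{d,m}$ is a homogeneous ideal of $\mathrm{Sym}(B_d)$. Let $$\mathrm{Sec}_{d,r}(X)=\bigoplus_{m\ge 0}\mathrm{Sym}^m(B_d)/I(r)_{d,m}$$ be the corresponding quotient ring (the coordinate ring of the $r$th secant variety of the $d$th Veronese embedding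 of $X$), graded by $m$. Then there is a function $C_X(i,r)$ of integers $i\ge 0$ and $r\ge 1$, depending on $X$, $i$, $r$ but not on $d$, such that for all $i\ge 0$, $r\ge 1$ and $d\ge 0$ the graded $\mathrm{Sym}(B_d)$-module $\mathrm{Tor}_i^{\mathrm{Sym}(B_d)}(\mathrm{Sec}_{d,r}(X),k)$ is concentrated in degrees $\le C_X(i,r)$. Here $k=\mathrm{Sym}(B_d)/\bigoplus_{m>0}\mathrm{Sym}^m(B_d)$, and the grading of $\mathrm{Tor}$ is the one computed from any graded free resolution of $\mathrm{Sec}_{d,r}(X)$. -/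

import Mathlib

open scoped TensorProduct DirectSum

universe u v w

namespace SecantSyzygies

section SymmetricPowers

variable (k : Type u) [Field k] (W : Type v) [AddCommGroup W] [Module k W]

/-- The symmetric power `Sym^m(W)`, as the degree `m` piece of `Sym(W)`: the span of all products
of `m` elements of `W`. -/
def symPow (m : ℕ) : Submodule k (SymmetricAlgebra k W) :=
  LinearMap.range (SymmetricAlgebra.ι k W) ^ m

instance : SetLike.GradedMonoid (symPow k W) :=
  inferInstanceAs (SetLike.GradedMonoid
    ((LinearMap.range (SymmetricAlgebra.ι k W) ^ ·) : ℕ → Submodule k (SymmetricAlgebra k W)))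

theorem ι_mem_symPow (x : W) : SymmetricAlgebra.ι k W x ∈ symPow k W 1 := by
  rw [symPow, pow_one]; exact LinearMap.mem_range_self _ x

/-- The inclusion of `W` in the direct sum of the symmetric powers. -/
noncomputable def gradedι : W →ₗ[k] ⨁ i : ℕ, symPow k W i :=
  DirectSum.lof k ℕ (fun i => symPow k W i) 1 ∘ₗ
    (SymmetricAlgebra.ι k W).codRestrict _ (ι_mem_symPow k W)

theorem gradedι_apply (x : W) :
    gradedι k W x = DirectSum.of (fun i : ℕ => symPow k W i) 1
      ⟨SymmetricAlgebra.ι k W x, ι_mem_symPow k W x⟩ := rfl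

/-- `Sym(W)` is the direct sum of the symmetric powers `Sym^m(W)`. -/
noncomputable instance : GradedAlgebra (symPow k W) :=
  GradedAlgebra.ofAlgHom _ (SymmetricAlgebra.lift (gradedι k W))
    (by
      ext x
      change DirectSum.coeAlgHom (symPow k W)
        (SymmetricAlgebra.lift (gradedι k W) (SymmetricAlgebra.ι k W x)) = _
      rw [SymmetricAlgebra.lift_ι_apply, gradedι_apply, DirectSum.coeAlgHom_of]
      rfl)
    fun i x => by
      obtain ⟨x, hx⟩ := x
      dsimp only [Subtype.coe_mk, DirectSum.lof_eq_of]
      unfold symPow at hx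
      induction hx using Submodule.pow_induction_on_left' with
      | algebraMap r =>
        rw [AlgHom.commutes, DirectSum.algebraMap_apply]; rfl
      | add x y i hx hy ihx ihy =>
        rw [map_add, ihx, ihy, ← map_add]; rfl
      | mem_mul m hm i x hx ih =>
        obtain ⟨_, rfl⟩ := hm
        rw [map_mul, ih, SymmetricAlgebra.lift_ι_apply, gradedι_apply, DirectSum.of_mul_of]
        exact DirectSum.of_eq_of_gradedMonoid_eq (Sigma.subtype_ext (add_comm _ _) rfl)

/-- The projection `Sym(W) → Sym^m(W)`. -/
noncomputable def symProj (m : ℕ) : SymmetricAlgebra k W →ₗ[k] symPow k W m :=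
  DirectSum.component k ℕ (fun i => symPow k W i) m ∘ₗ
    (DirectSum.decomposeLinearEquiv (symPow k W)).toLinearMap

theorem symProj_apply (m : ℕ) (x : SymmetricAlgebra k W) :
    symProj k W m x = DirectSum.decompose (symPow k W) x m := rfl

/-- The component `Sym(W) → Sym^i(W) ⊗ Sym^j(W)` of the comultiplication of `Sym(W)`, the algebra
homomorphism `Sym(W) → Sym(W) ⊗ Sym(W)` with `x ↦ x ⊗ 1 + 1 ⊗ x` for `x ∈ W`. -/
noncomputable def comulPart (i j : ℕ) :
    SymmetricAlgebra k W →ₗ[k] symPow k W i ⊗[k] symPow k W j :=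
  TensorProduct.map (symProj k W i) (symProj k W j) ∘ₗ Coalgebra.comul

/-- Multiplication by `x ∈ W`, as a map `Sym^m(W) → Sym^(m+1)(W)`. -/
noncomputable def mulι (x : W) (m : ℕ) : symPow k W m →ₗ[k] symPow k W (m + 1) :=
  ((LinearMap.mulLeft k (SymmetricAlgebra.ι k W x)) ∘ₗ (symPow k W m).subtype).codRestrict _
    fun y => by
      have := SetLike.mul_mem_graded (ι_mem_symPow k W x) y.2
      rwa [add_comm] at this

variable {k W}

theorem symProj_succ_ι_mul (x : W) (m : ℕ) (s : SymmetricAlgebra k W) :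
    symProj k W (m + 1) (SymmetricAlgebra.ι k W x * s) = mulι k W x m (symProj k W m s) := by
  ext
  have h := DirectSum.coe_decompose_mul_add_of_left_mem (symPow k W) (j := m) (b := s)
    (ι_mem_symPow k W x)
  rw [add_comm 1 m] at h
  exact h

theorem symProj_zero_ι_mul (x : W) (s : SymmetricAlgebra k W) :
    symProj k W 0 (SymmetricAlgebra.ι k W x * s) = 0 := by
  ext
  rw [symProj_apply, DirectSum.coe_decompose_mul_of_left_mem_of_not_le (symPow k W)
    (ι_mem_symPow k W x) (by omega)]
  rfl

theorem comul_ι_mul (x : W) (s : SymmetricAlgebra k W) :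
    Coalgebra.comul (R := k) (SymmetricAlgebra.ι k W x * s) =
      (SymmetricAlgebra.ι k W x ⊗ₜ[k] 1) * Coalgebra.comul (R := k) s +
        (1 ⊗ₜ[k] SymmetricAlgebra.ι k W x) * Coalgebra.comul (R := k) s := by
  rw [Bialgebra.comul_mul, ← add_mul]
  congr 1
  exact SymmetricAlgebra.lift_ι_apply _ x

theorem comulPart_eq (i j : ℕ) (s : SymmetricAlgebra k W) :
    comulPart k W i j s =
      TensorProduct.map (symProj k W i) (symProj k W j) (Coalgebra.comul (R := k) s) := rfl

theorem map_symProj_left_mul (x : W) (a j : ℕ)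
    (t : SymmetricAlgebra k W ⊗[k] SymmetricAlgebra k W) :
    TensorProduct.map (symProj k W (a + 1)) (symProj k W j)
        ((SymmetricAlgebra.ι k W x ⊗ₜ[k] 1) * t) =
      TensorProduct.map (mulι k W x a) LinearMap.id
        (TensorProduct.map (symProj k W a) (symProj k W j) t) := by
  induction t using TensorProduct.induction_on with
  | zero => simp
  | tmul u v => simp [symProj_succ_ι_mul]
  | add u v hu hv => simp only [mul_add, map_add, hu, hv]

theorem map_symProj_left_mul_zero (x : W) (j : ℕ)
    (t : SymmetricAlgebra k W ⊗[k] SymmetricAlgebra k W) :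
    TensorProduct.map (symProj k W 0) (symProj k W j)
        ((SymmetricAlgebra.ι k W x ⊗ₜ[k] 1) * t) = 0 := by
  induction t using TensorProduct.induction_on with
  | zero => simp
  | tmul u v => simp [symProj_zero_ι_mul]
  | add u v hu hv => simp only [mul_add, map_add, hu, hv, add_zero]

theorem map_symProj_right_mul (x : W) (i b : ℕ)
    (t : SymmetricAlgebra k W ⊗[k] SymmetricAlgebra k W) :
    TensorProduct.map (symProj k W i) (symProj k W (b + 1))
        ((1 ⊗ₜ[k] SymmetricAlgebra.ι k W x) * t) =
      TensorProduct.map LinearMap.id (mulι k W x b)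
        (TensorProduct.map (symProj k W i) (symProj k W b) t) := by
  induction t using TensorProduct.induction_on with
  | zero => simp
  | tmul u v => simp [symProj_succ_ι_mul]
  | add u v hu hv => simp only [mul_add, map_add, hu, hv]

theorem map_symProj_right_mul_zero (x : W) (i : ℕ)
    (t : SymmetricAlgebra k W ⊗[k] SymmetricAlgebra k W) :
    TensorProduct.map (symProj k W i) (symProj k W 0)
        ((1 ⊗ₜ[k] SymmetricAlgebra.ι k W x) * t) = 0 := by
  induction t using TensorProduct.induction_on with
  | zero => simp
  | tmul u v => simp [symProj_zero_ι_mul]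
  | add u v hu hv => simp only [mul_add, map_add, hu, hv, add_zero]

/-- If `P` and `Q` are families of subspaces of the symmetric powers closed under multiplication by
`W`, then so is the kernel of `Sym^m → ⨁_{i+j=m} Sym^i/P_i ⊗ Sym^j/Q_j`. -/
theorem comulPart_ι_mul (P Q : (m : ℕ) → Submodule k (symPow k W m)) (x : W)
    (hP : ∀ m, P m ≤ (P (m + 1)).comap (mulι k W x m))
    (hQ : ∀ m, Q m ≤ (Q (m + 1)).comap (mulι k W x m)) (m : ℕ) (s : SymmetricAlgebra k W)
    (hs : ∀ i j, i + j = m →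
      TensorProduct.map (P i).mkQ (Q j).mkQ (comulPart k W i j s) = 0) (i j : ℕ)
    (hij : i + j = m + 1) :
    TensorProduct.map (P i).mkQ (Q j).mkQ
      (comulPart k W i j (SymmetricAlgebra.ι k W x * s)) = 0 := by
  rw [comulPart_eq, comul_ι_mul, map_add, map_add]
  have hl : TensorProduct.map (P i).mkQ (Q j).mkQ
      (TensorProduct.map (symProj k W i) (symProj k W j)
        ((SymmetricAlgebra.ι k W x ⊗ₜ[k] 1) * Coalgebra.comul (R := k) s)) = 0 := by
    cases i with
    | zero => rw [map_symProj_left_mul_zero, map_zero]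
    | succ a =>
      rw [map_symProj_left_mul, ← LinearMap.comp_apply, ← TensorProduct.map_comp]
      have : (P (a + 1)).mkQ ∘ₗ mulι k W x a = (P a).mapQ _ _ (hP a) ∘ₗ (P a).mkQ := by
        ext; rfl
      rw [this, LinearMap.comp_id, ← LinearMap.id_comp (Q j).mkQ, TensorProduct.map_comp,
        LinearMap.comp_apply, ← comulPart_eq, hs a j (by omega), map_zero]
  have hr : TensorProduct.map (P i).mkQ (Q j).mkQ
      (TensorProduct.map (symProj k W i) (symProj k W j)
        ((1 ⊗ₜ[k] SymmetricAlgebra.ι k W x) * Coalgebra.comul (R := k) s)) = 0 := by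
    cases j with
    | zero => rw [map_symProj_right_mul_zero, map_zero]
    | succ b =>
      rw [map_symProj_right_mul, ← LinearMap.comp_apply, ← TensorProduct.map_comp]
      have : (Q (b + 1)).mkQ ∘ₗ mulι k W x b = (Q b).mapQ _ _ (hQ b) ∘ₗ (Q b).mkQ := by
        ext; rfl
      rw [this, LinearMap.comp_id, ← LinearMap.id_comp (P i).mkQ, TensorProduct.map_comp,
        LinearMap.comp_apply, ← comulPart_eq, hs i b (by omega), map_zero]
  rw [hl, hr, add_zero]

end SymmetricPowers

section Secant

variable {k : Type u} [Field k] {B : Type v} [CommRing B] [Algebra k B]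

/-- For a subspace `W` of `B`, the degree `m` part of the kernel of the multiplication
map `Sym(W) → B`. -/
noncomputable def veronesePart (W : Submodule k B) (m : ℕ) : Submodule k (symPow k W m) :=
  LinearMap.ker ((SymmetricAlgebra.lift W.subtype).toLinearMap ∘ₗ (symPow k W m).subtype)

/-- The degree `m` part of the `r`th secant ideal, for `r ≥ 1`: for `r = 1` it is the kernel of the
multiplication map `Sym^m(W) → B`, and for `r + 1` it is the kernel of the comultiplication
`Sym^m(W) → ⨁_{i+j=m} Sym^i(W)/I(1)_i ⊗ Sym^j(W)/I(r)_j`. The value at `r = 0` is a convention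
that is not used. -/
noncomputable def secantPart (W : Submodule k B) : ℕ → (m : ℕ) → Submodule k (symPow k W m)
  | 0, _ => ⊤
  | 1, m => veronesePart W m
  | r + 2, m => LinearMap.ker (LinearMap.pi fun p : {p : ℕ × ℕ // p.1 + p.2 = m} =>
      TensorProduct.map (veronesePart W p.1.1).mkQ (secantPart W (r + 1) p.1.2).mkQ ∘ₗ
        comulPart k W p.1.1 p.1.2 ∘ₗ (symPow k W m).subtype)

theorem veronesePart_mulι (W : Submodule k B) (x : W) (m : ℕ) :
    veronesePart W m ≤ (veronesePart W (m + 1)).comap (mulι k W x m) := by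
  intro y hy
  have hy' : SymmetricAlgebra.lift W.subtype (y : SymmetricAlgebra k W) = 0 := hy
  change SymmetricAlgebra.lift W.subtype
    (SymmetricAlgebra.ι k W x * (y : SymmetricAlgebra k W)) = 0
  rw [map_mul, hy', mul_zero]

theorem mem_secantPart_succ_succ (W : Submodule k B) (r m : ℕ) (y : symPow k W m) :
    y ∈ secantPart W (r + 2) m ↔ ∀ i j, i + j = m →
      TensorProduct.map (veronesePart W i).mkQ (secantPart W (r + 1) j).mkQ
        (comulPart k W i j (y : SymmetricAlgebra k W)) = 0 := by
  rw [secantPart, LinearMap.mem_ker, funext_iff]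
  exact ⟨fun h i j hij => h ⟨(i, j), hij⟩, fun h p => h p.1.1 p.1.2 p.2⟩

theorem secantPart_mulι (W : Submodule k B) (x : W) (r : ℕ) : ∀ m,
    secantPart W r m ≤ (secantPart W r (m + 1)).comap (mulι k W x m) := by
  match r with
  | 0 => intro m y _; exact Submodule.mem_top
  | 1 => exact veronesePart_mulι W x
  | r + 2 =>
    intro m y hy
    rw [mem_secantPart_succ_succ] at hy
    rw [Submodule.mem_comap, mem_secantPart_succ_succ]
    exact comulPart_ι_mul (veronesePart W) (secantPart W (r + 1)) x (veronesePart_mulι W x)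
      (secantPart_mulι W x (r + 1)) m y hy

/-- The `r`th secant ideal `⨁_m I(r)_m` of `Sym(W)`. -/
noncomputable def secantIdeal (W : Submodule k B) (r : ℕ) : Ideal (SymmetricAlgebra k W) where
  carrier := {s | ∀ m, symProj k W m s ∈ secantPart W r m}
  zero_mem' m := by rw [map_zero]; exact zero_mem _
  add_mem' hs ht m := by rw [map_add]; exact add_mem (hs m) (ht m)
  smul_mem' c s hs := by
    change ∀ m, symProj k W m s ∈ secantPart W r m at hs
    change ∀ m, symProj k W m (c * s) ∈ secantPart W r m
    induction c using SymmetricAlgebra.induction generalizing s with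
    | algebraMap a =>
      intro m
      rw [← Algebra.smul_def, map_smul]
      exact Submodule.smul_mem _ _ (hs m)
    | ι x =>
      rintro (_ | m)
      · rw [symProj_zero_ι_mul]; exact zero_mem _
      · rw [symProj_succ_ι_mul]; exact secantPart_mulι W x r m (hs m)
    | mul a b ha hb => rw [mul_assoc]; exact ha _ (hb _ hs)
    | add a b ha hb =>
      intro m
      rw [add_mul, map_add]
      exact add_mem (ha s hs m) (hb s hs m)

theorem secantIdeal_isHomogeneous (W : Submodule k B) (r : ℕ) :
    (secantIdeal W r).IsHomogeneous (symPow k W) := by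
  intro i s hs m
  by_cases h : i = m
  · subst h
    have : symProj k W i (DirectSum.decompose (symPow k W) s i : SymmetricAlgebra k W) =
        symProj k W i s := by
      ext; rw [symProj_apply, DirectSum.decompose_coe, DirectSum.of_eq_same]; rfl
    rw [this]
    exact hs i
  · have : symProj k W m (DirectSum.decompose (symPow k W) s i : SymmetricAlgebra k W) = 0 := by
      ext; rw [symProj_apply, DirectSum.decompose_coe, DirectSum.of_eq_of_ne _ _ _ (Ne.symm h)]
    rw [this]
    exact zero_mem _

end Secant

section Tor

variable {k : Type u} [Field k] {S : Type v} [CommRing S] [Algebra k S]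
  (𝒜 : ℕ → Submodule k S) [GradedAlgebra 𝒜]

/-- The degree `m` part of the shifted module `S(-e)`: it is `𝒜 (m - e)` if `e ≤ m`, and zero
otherwise. -/
def shiftPart (e m : ℕ) : Submodule k S := if e ≤ m then 𝒜 (m - e) else ⊥

/-- The degree `m` part of the free graded module `⨁_a S(-deg a)` on a basis indexed by `G`, where
the basis element of index `a` has degree `deg a`. -/
def freePart {G : Type v} (deg : G → ℕ) (m : ℕ) : Submodule k (G →₀ S) where
  carrier := {f | ∀ a, f a ∈ shiftPart 𝒜 (deg a) m}
  zero_mem' a := by rw [Finsupp.zero_apply]; exact zero_mem _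
  add_mem' hf hg a := by rw [Finsupp.add_apply]; exact add_mem (hf a) (hg a)
  smul_mem' c f hf a := by rw [Finsupp.smul_apply]; exact Submodule.smul_mem _ c (hf a)

/-- A resolution of a graded `S`-module `M = ⨁_m ℳ m` by free graded modules, with
homogeneous maps of degree zero. The `n`th term has a basis indexed by `gen n`. -/
structure GradedFreeResolution {M : Type w} [AddCommGroup M] [Module S M] [Module k M]
    (ℳ : ℕ → Submodule k M) where
  gen : ℕ → Type v
  deg : (n : ℕ) → gen n → ℕ
  d : (n : ℕ) → (gen (n + 1) →₀ S) →ₗ[S] (gen n →₀ S)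
  aug : (gen 0 →₀ S) →ₗ[S] M
  d_mem : ∀ n m f, f ∈ freePart 𝒜 (deg (n + 1)) m → d n f ∈ freePart 𝒜 (deg n) m
  aug_mem : ∀ m f, f ∈ freePart 𝒜 (deg 0) m → aug f ∈ ℳ m
  exact : ∀ n, Function.Exact (d (n + 1)) (d n)
  exact_aug : Function.Exact (d 0) aug
  aug_surjective : Function.Surjective aug

/-- The quotient of `S` by the ideal of elements of positive degree. -/
abbrev ResidueRing : Type v := S ⧸ (HomogeneousIdeal.irrelevant 𝒜).toIdeal

namespace GradedFreeResolution

variable {𝒜} {M : Type w} [AddCommGroup M] [Module S M] [Module k M] {ℳ : ℕ → Submodule k M}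
  (F : GradedFreeResolution 𝒜 ℳ)

/-- The terms of the resolution tensored with `S/S_+`. -/
abbrev Term (n : ℕ) : Type v := ResidueRing 𝒜 ⊗[S] (F.gen n →₀ S)

/-- The differential of the resolution tensored with `S/S_+`. -/
noncomputable def dTensor (n : ℕ) : F.Term (n + 1) →ₗ[k] F.Term n :=
  ((F.d n).lTensor (ResidueRing 𝒜)).restrictScalars k

/-- The part of degree `m` of the resolution tensored with `S/S_+`. -/
noncomputable def termPart (n m : ℕ) : Submodule k (F.Term n) :=
  (freePart 𝒜 (F.deg n) m).map
    ((TensorProduct.mk S (ResidueRing 𝒜) (F.gen n →₀ S) 1).restrictScalars k)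

/-- The cycles of degree `m`. -/
noncomputable def cycles : (n m : ℕ) → Submodule k (F.Term n)
  | 0, m => F.termPart 0 m
  | n + 1, m => F.termPart (n + 1) m ⊓ LinearMap.ker (F.dTensor n)

/-- The boundaries of degree `m`. -/
noncomputable def boundaries (n m : ℕ) : Submodule k (F.Term n) :=
  (F.termPart (n + 1) m).map (F.dTensor n)

/-- The degree `m` part of `Tor_n^S(M, S/S_+)`, computed by the resolution `F`: the cycles of
degree `m` modulo the boundaries of degree `m`. -/
noncomputable def Tor (n m : ℕ) : Submodule k (F.Term n ⧸ F.boundaries n m) :=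
  (F.cycles n m).map (F.boundaries n m).mkQ

end GradedFreeResolution

/-- The grading of `S/J` induced from the grading of `S`. -/
def quotientPart (J : Ideal S) (m : ℕ) : Submodule k (S ⧸ J) :=
  (𝒜 m).map (Ideal.Quotient.mkₐ k J).toLinearMap

section Existence

/-- The degree `m` component of an element of the free graded module. -/
noncomputable def freeProj {G : Type v} (deg : G → ℕ) (m : ℕ) : (G →₀ S) →ₗ[k] (G →₀ S) where
  toFun f := Finsupp.onFinset f.support
    (fun a => if deg a ≤ m then GradedAlgebra.proj 𝒜 (m - deg a) (f a) else 0)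
    fun a ha => by
      rw [Finsupp.mem_support_iff]
      rintro h
      simp [h] at ha
  map_add' f g := by ext a; simp only [Finsupp.onFinset_apply, Finsupp.add_apply]; split <;> simp
  map_smul' c f := by
    ext a
    simp only [Finsupp.onFinset_apply, Finsupp.smul_apply, RingHom.id_apply]; split <;> simp

theorem freeProj_apply {G : Type v} (deg : G → ℕ) (m : ℕ) (f : G →₀ S) (a : G) :
    freeProj 𝒜 deg m f a = if deg a ≤ m then GradedAlgebra.proj 𝒜 (m - deg a) (f a) else 0 := rfl

theorem freeProj_mem {G : Type v} (deg : G → ℕ) (m : ℕ) (f : G →₀ S) :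
    freeProj 𝒜 deg m f ∈ freePart 𝒜 deg m := by
  intro a
  rw [freeProj_apply, shiftPart]
  split
  · exact SetLike.coe_mem _
  · exact zero_mem _

theorem freeProj_smul {G : Type v} (deg : G → ℕ) (m e : ℕ) (s : S) (f : G →₀ S)
    (hf : f ∈ freePart 𝒜 deg e) :
    freeProj 𝒜 deg m (s • f) = if e ≤ m then GradedAlgebra.proj 𝒜 (m - e) s • f else 0 := by
  ext a
  have ha : f a ∈ shiftPart 𝒜 (deg a) e := hf a
  rw [freeProj_apply, shiftPart] at *
  rw [Finsupp.smul_apply, smul_eq_mul]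
  by_cases hae : deg a ≤ e
  · rw [if_pos hae] at ha
    by_cases hem : e ≤ m
    · rw [if_pos (hae.trans hem), if_pos hem, Finsupp.smul_apply, smul_eq_mul,
        GradedAlgebra.proj_apply, GradedAlgebra.proj_apply]
      have h := DirectSum.coe_decompose_mul_add_of_right_mem 𝒜 (i := m - e) (a := s) ha
      rwa [show m - e + (e - deg a) = m - deg a by omega] at h
    · rw [if_neg hem]
      split
      · rw [GradedAlgebra.proj_apply,
          DirectSum.coe_decompose_mul_of_right_mem_of_not_le 𝒜 ha (by omega)]
        rfl
      · rfl
  · rw [if_neg hae, Submodule.mem_bot] at ha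
    rw [ha]
    split <;> split <;> simp [ha]

theorem freeProj_of_mem {G : Type v} (deg : G → ℕ) (m e : ℕ) (f : G →₀ S)
    (hf : f ∈ freePart 𝒜 deg e) : freeProj 𝒜 deg m f = if m = e then f else 0 := by
  have h := freeProj_smul 𝒜 deg m e 1 f hf
  rw [one_smul] at h
  rw [h, GradedAlgebra.proj_apply]
  by_cases hme : m = e
  · subst hme
    rw [if_pos le_rfl, if_pos rfl, Nat.sub_self,
      DirectSum.decompose_of_mem_same 𝒜 SetLike.GradedOne.one_mem, one_smul]
  · rw [if_neg hme]
    split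
    · rw [DirectSum.decompose_of_mem_ne 𝒜 SetLike.GradedOne.one_mem (by omega), zero_smul]
    · rfl

theorem sum_freeProj {G : Type v} (deg : G → ℕ) (f : G →₀ S) :
    ∃ N : ℕ, ∀ n ≥ N, ∑ m ∈ Finset.range n, freeProj 𝒜 deg m f = f := by
  have hadd : ∀ f g : G →₀ S,
      (∃ N : ℕ, ∀ n ≥ N, ∑ m ∈ Finset.range n, freeProj 𝒜 deg m f = f) →
      (∃ N : ℕ, ∀ n ≥ N, ∑ m ∈ Finset.range n, freeProj 𝒜 deg m g = g) →
      ∃ N : ℕ, ∀ n ≥ N, ∑ m ∈ Finset.range n, freeProj 𝒜 deg m (f + g) = f + g := by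
    rintro f g ⟨N, hN⟩ ⟨N', hN'⟩
    refine ⟨max N N', fun n hn => ?_⟩
    simp only [map_add, Finset.sum_add_distrib]
    rw [hN n ((le_max_left _ _).trans hn), hN' n ((le_max_right _ _).trans hn)]
  induction f using Finsupp.induction_linear with
  | zero => exact ⟨0, by simp⟩
  | add f g hf hg => exact hadd f g hf hg
  | single a s =>
    induction s using DirectSum.Decomposition.inductionOn 𝒜 with
    | zero => exact ⟨0, by simp⟩
    | @homogeneous j s =>
      have hs : Finsupp.single a (s : S) ∈ freePart 𝒜 deg (deg a + j) := by
        intro b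
        by_cases hb : a = b
        · subst hb
          rw [Finsupp.single_eq_same, shiftPart, if_pos (by omega), Nat.add_sub_cancel_left]
          exact s.2
        · rw [Finsupp.single_eq_of_ne (Ne.symm hb)]
          exact zero_mem _
      refine ⟨deg a + j + 1, fun n hn => ?_⟩
      simp only [freeProj_of_mem 𝒜 deg _ _ _ hs]
      rw [Finset.sum_ite_eq', if_pos (Finset.mem_range.2 hn)]
    | add s t hs ht => rw [Finsupp.single_add]; exact hadd _ _ hs ht

/-- A homogeneous submodule of a free graded module, the syzygies at one step of a resolution. -/
structure SyzygyStage where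
  gen : Type v
  deg : gen → ℕ
  syz : Submodule S (gen →₀ S)
  proj_mem : ∀ m, ∀ f ∈ syz, freeProj 𝒜 deg m f ∈ syz

namespace SyzygyStage

variable {𝒜} (T : SyzygyStage 𝒜)

/-- All homogeneous elements of the submodule, with their degrees. -/
def NextGen : Type v := {p : ℕ × (T.gen →₀ S) // p.2 ∈ T.syz ∧ p.2 ∈ freePart 𝒜 T.deg p.1}

/-- The map from the free module on all homogeneous elements of the submodule. -/
noncomputable def nextMap : (T.NextGen →₀ S) →ₗ[S] (T.gen →₀ S) :=
  Finsupp.linearCombination S fun p : T.NextGen => p.1.2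

theorem nextMap_freeProj (m : ℕ) (f : T.NextGen →₀ S) :
    T.nextMap (freeProj 𝒜 (fun p : T.NextGen => p.1.1) m f) =
      freeProj 𝒜 T.deg m (T.nextMap f) := by
  induction f using Finsupp.induction_linear with
  | zero => simp
  | add f g hf hg => simp only [map_add, hf, hg]
  | single p s =>
    have h : freeProj 𝒜 (fun p : T.NextGen => p.1.1) m (Finsupp.single p s) =
        Finsupp.single p (if p.1.1 ≤ m then GradedAlgebra.proj 𝒜 (m - p.1.1) s else 0) := by
      ext q
      rw [freeProj_apply]
      by_cases hq : p = q
      · subst hq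
        rw [Finsupp.single_eq_same, Finsupp.single_eq_same]
      · rw [Finsupp.single_eq_of_ne (Ne.symm hq), Finsupp.single_eq_of_ne (Ne.symm hq), map_zero,
          ite_self]
    rw [h, nextMap, Finsupp.linearCombination_single, Finsupp.linearCombination_single,
      freeProj_smul 𝒜 T.deg m p.1.1 s p.1.2 p.2.2]
    split
    · rfl
    · rw [zero_smul]

theorem range_nextMap : LinearMap.range T.nextMap = T.syz := by
  apply le_antisymm
  · rw [nextMap, Finsupp.range_linearCombination, Submodule.span_le]
    rintro _ ⟨p, rfl⟩
    exact p.2.1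
  · intro f hf
    obtain ⟨N, hN⟩ := sum_freeProj 𝒜 T.deg f
    rw [← hN N le_rfl]
    refine Submodule.sum_mem _ fun m _ => ?_
    exact ⟨Finsupp.single ⟨(m, freeProj 𝒜 T.deg m f), T.proj_mem m f hf, freeProj_mem 𝒜 _ _ _⟩ 1,
      (Finsupp.linearCombination_single S (1 : S) _).trans (one_smul S _)⟩

theorem nextMap_mem (m : ℕ) (f : T.NextGen →₀ S)
    (hf : f ∈ freePart 𝒜 (fun p : T.NextGen => p.1.1) m) :
    T.nextMap f ∈ freePart 𝒜 T.deg m := by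
  have h := T.nextMap_freeProj m f
  rw [freeProj_of_mem 𝒜 _ m m f hf, if_pos rfl] at h
  rw [h]
  exact freeProj_mem 𝒜 _ _ _

/-- The next step of the resolution. -/
noncomputable def next : SyzygyStage 𝒜 where
  gen := T.NextGen
  deg p := p.1.1
  syz := LinearMap.ker T.nextMap
  proj_mem m f hf := by
    rw [LinearMap.mem_ker] at hf ⊢
    rw [nextMap_freeProj, hf, map_zero]

/-- Iterating `next`. -/
noncomputable def iter : ℕ → SyzygyStage 𝒜
  | 0 => T
  | n + 1 => (iter n).next

end SyzygyStage

/-- Every quotient of `S` by a homogeneous ideal has a graded free resolution. -/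
theorem exists_gradedFreeResolution (J : Ideal S) (hJ : J.IsHomogeneous 𝒜) :
    Nonempty (GradedFreeResolution 𝒜 (quotientPart 𝒜 J)) := by
  let π : (PUnit.{v + 1} →₀ S) →ₗ[S] (S ⧸ J) := J.mkQ ∘ₗ Finsupp.lapply PUnit.unit
  have hπ : ∀ f, π f = Ideal.Quotient.mk J (f PUnit.unit) := fun _ => rfl
  let T : SyzygyStage 𝒜 :=
    { gen := PUnit
      deg := fun _ => 0
      syz := LinearMap.ker π
      proj_mem := fun m f hf => by
        rw [LinearMap.mem_ker, hπ, Ideal.Quotient.eq_zero_iff_mem] at hf ⊢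
        rw [freeProj_apply, if_pos (Nat.zero_le m)]
        exact hJ _ hf }
  refine ⟨⟨fun n => (T.iter n).gen, fun n => (T.iter n).deg, fun n => (T.iter n).nextMap, π,
    ?_, ?_, ?_, ?_, ?_⟩⟩
  · exact fun n m f hf => (T.iter n).nextMap_mem m f hf
  · intro m f hf
    have h : f PUnit.unit ∈ shiftPart 𝒜 0 m := hf PUnit.unit
    rw [shiftPart, if_pos (Nat.zero_le m)] at h
    exact ⟨f PUnit.unit, h, rfl⟩
  · exact fun n y => (SetLike.ext_iff.1 (T.iter (n + 1)).range_nextMap y).symm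
  · exact fun y => (SetLike.ext_iff.1 T.range_nextMap y).symm
  · intro y
    obtain ⟨s, rfl⟩ := Ideal.Quotient.mk_surjective y
    exact ⟨Finsupp.single PUnit.unit s, congrArg (Ideal.Quotient.mk J) Finsupp.single_eq_same⟩

end Existence

end Tor

section Cone

variable {k : Type u} [Field k] {V : Type v} [AddCommGroup V] [Module k V]

/-- The homogeneous coordinate ring `B = Sym(V)/I_X` of the conical subscheme `X` with defining
ideal `I_X`. -/
abbrev CoordRing (I : HomogeneousIdeal (symPow k V)) : Type (max u v) :=
  SymmetricAlgebra k V ⧸ I.toIdeal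

/-- The degree `d` part `B_d` of the coordinate ring `B = Sym(V)/I_X`. -/
noncomputable abbrev coordPart (I : HomogeneousIdeal (symPow k V)) (d : ℕ) : Submodule k (CoordRing I) :=
  quotientPart (symPow k V) I.toIdeal d

/-- The ring `Sec_{d,r}(X)`, as a quotient of `Sym(B_d)`. -/
abbrev SecRing (I : HomogeneousIdeal (symPow k V)) (d r : ℕ) : Type (max u v) :=
  SymmetricAlgebra k (coordPart I d) ⧸ secantIdeal (coordPart I d) r

/-- The grading of `Sec_{d,r}(X)` with degree `m` part `Sym^m(B_d)/I(r)_m`. -/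
noncomputable abbrev secPart (I : HomogeneousIdeal (symPow k V)) (d r m : ℕ) :
    Submodule k (SecRing I d r) :=
  quotientPart (symPow k (coordPart I d)) (secantIdeal (coordPart I d) r) m

/-- `Sec_{d,r}(X)` has a graded free resolution over `Sym(B_d)`. -/
theorem exists_resolution_secRing (I : HomogeneousIdeal (symPow k V)) (d r : ℕ) :
    Nonempty (GradedFreeResolution (symPow k (coordPart I d)) (secPart I d r)) :=
  exists_gradedFreeResolution _ _ (secantIdeal_isHomogeneous _ r)

end Cone

end SecantSyzygies

/-!
The idea is to compute `Tor` by Koszul homology, and to lift Koszul cycles to combinations of words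
in which all degrees `d` can be treated at once.

*Koszul homology.* Let `W = B_d`. The Koszul complex of a graded `Sym(W)`-module `M`, in exterior
degree `i`, consists of the alternating maps in `i` functionals on `W` with values in `M`. In
characteristic zero the Euler operator contracts the Koszul complex of a free module
(`exists_symKoszul_eq_of_free`, `exists_symKoszul_eq_of_irrelevant`), and a chase in the double
complex attached to a graded free resolution shows that `Tor_i` vanishes in degree `m` when the
Koszul homology of `M` does (`GradedFreeResolution.tor_eq_bot`).

*Secant rings.* The `r`th secant ideal is the kernel of the homomorphism from `Sym(W)` to
`B^{⊗ r}[X_1, …, X_r]` that sends `w` to the sum of the `w_j X_j`, where `w_j` is the image of `w`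
in the `j`th tensor factor (`exists_secantPart_iff`). Only this description of the ideal is used
afterwards.

*Words.* Let `x_1, …, x_N` generate `B` in degree one. A letter is a monomial of degree `d` in
them, and may carry one of the markers `1, …, i`. A word in which every marker occurs once has a
value in `⋀ⁱ W ⊗ Sym(W)`: the marked letters are the exterior factors. Every element of the Koszul
complex of the secant ring is the value of a combination of words that is symmetric in the positions
and alternating in the markers (`exists_symmetric_wordVal_eq`). The Koszul differential unmarks a
letter, so by the description of the secant ideal the value of such a combination is a cycle if and
only if certain linear conditions hold, one for every coloring of the positions by the remaining
markers and the `r` tensor factors and every choice of functionals on `B` (`colorVal_eq_zero`,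
`symKoszul_eq_zero_of_mem_cycleWords`).

*Noetherianity.* The combinations that satisfy these conditions are closed under multiplying the
letters, position by position, by monomials of a fixed degree, which changes `d`, and under the
insertion of an unmarked letter (`isWordFamily_cycleWords`). Leading words and Higman's lemma then
give a bound `C` that does not depend on `d` such that every such combination of words longer than
`C` is a sum of insertions in shorter ones (`IsWordFamily.exists_le_span`). The value of an
insertion is the product of a cycle with an element of `W`, and multiplication by an element of `W`
is homotopic to zero on the Koszul complex (`koszul_wedge`). So all cycles of total degree greater
than `C` are boundaries (`exists_bound_koszul_succ`).
-/

namespace SecantSyzygies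

/-! ### The Koszul differential -/

section Koszul

variable {k : Type*} [Field k] {S : Type*} [CommRing S] [Algebra k S]
  {E : Type*} [AddCommGroup E] [Module k E] {κ : Type*} [Fintype κ]
  {M : Type*} [AddCommGroup M] [Module k M] [Module S M] [IsScalarTower k S M]
  {M' : Type*} [AddCommGroup M'] [Module k M'] [Module S M'] [IsScalarTower k S M']

theorem alternatingMap_sum_apply {α : Type*} (s : Finset α) {n : ℕ} (f : α → E [⋀^Fin n]→ₗ[k] M)
    (v : Fin n → E) : (∑ a ∈ s, f a) v = ∑ a ∈ s, f a v := by
  classical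
  induction s using Finset.induction_on with
  | empty => simp
  | insert a s ha ih => simp [Finset.sum_insert ha, ih]

/-- The Koszul differential on alternating maps: `(∂ y)(v) = ∑ b, x b • y (e b, v)`. When `e` is
the basis of `E` dual to a basis of `W` with image `x` in `S`, the alternating maps from `E` to `M`
in `n` variables are `⋀ⁿ W ⊗ M`, and this is the usual Koszul differential up to a scalar. -/
noncomputable def koszul (e : κ → E) (x : κ → S) {n : ℕ} (y : E [⋀^Fin (n + 1)]→ₗ[k] M) :
    E [⋀^Fin n]→ₗ[k] M :=
  ∑ b, (Algebra.lsmul k k M (x b)).compAlternatingMap (y.curryLeft (e b))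

variable (e : κ → E) (x : κ → S)

theorem koszul_apply {n : ℕ} (y : E [⋀^Fin (n + 1)]→ₗ[k] M) (v : Fin n → E) :
    koszul e x y v = ∑ b, x b • y (Matrix.vecCons (e b) v) := by
  simp [koszul, alternatingMap_sum_apply]

theorem koszul_add {n : ℕ} (y z : E [⋀^Fin (n + 1)]→ₗ[k] M) :
    koszul e x (y + z) = koszul e x y + koszul e x z := by
  ext v
  simp [koszul_apply, Finset.sum_add_distrib]

theorem koszul_smul (c : k) {n : ℕ} (y : E [⋀^Fin (n + 1)]→ₗ[k] M) :
    koszul e x (c • y) = c • koszul e x y := by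
  ext v
  simp only [koszul_apply, AlternatingMap.smul_apply, Finset.smul_sum]
  exact Finset.sum_congr rfl fun b _ => smul_comm _ _ _

theorem koszul_comp (φ : M →ₗ[S] M') {n : ℕ} (y : E [⋀^Fin (n + 1)]→ₗ[k] M) :
    koszul e x ((φ.restrictScalars k).compAlternatingMap y) =
      (φ.restrictScalars k).compAlternatingMap (koszul e x y) := by
  ext v
  simp [koszul_apply]

theorem koszul_koszul [CharZero k] {n : ℕ} (y : E [⋀^Fin (n + 2)]→ₗ[k] M) :
    koszul e x (koszul e x y) = 0 := by
  ext v
  simp only [koszul_apply, Finset.smul_sum]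
  set f : κ → κ → M := fun b c => x b • x c • y (Matrix.vecCons (e c) (Matrix.vecCons (e b) v))
  have hf : ∀ b c, f b c = - f c b := by
    intro b c
    have h := y.map_swap (Matrix.vecCons (e b) (Matrix.vecCons (e c) v))
      (show (0 : Fin (n + 2)) ≠ 1 by simp)
    have h' : Matrix.vecCons (e b) (Matrix.vecCons (e c) v) ∘
        Equiv.swap (0 : Fin (n + 2)) 1 = Matrix.vecCons (e c) (Matrix.vecCons (e b) v) := by
      funext j
      refine Fin.cases ?_ (fun j => Fin.cases ?_ (fun j => ?_) j) j
      · simp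
      · simp
      · rw [Function.comp_apply, Equiv.swap_apply_of_ne_of_ne (by simp)
          (by
            rw [← Fin.succ_zero_eq_one]
            exact fun h => Fin.succ_ne_zero _ (Fin.succ_injective _ h))]
        rfl
    rw [h'] at h
    simp only [f, h, smul_neg]
    rw [smul_comm]
  have h : ∑ b, ∑ c, f b c = - ∑ b, ∑ c, f b c := by
    conv_lhs => rw [Finset.sum_comm]
    rw [← Finset.sum_neg_distrib]
    refine Finset.sum_congr rfl fun b _ => ?_
    rw [← Finset.sum_neg_distrib]
    exact Finset.sum_congr rfl fun c _ => hf c b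
  have h2 : (2 : k) • ∑ b, ∑ c, f b c = 0 := by
    rw [two_smul]
    exact add_eq_zero_iff_eq_neg.2 h
  exact (smul_eq_zero.1 h2).resolve_left two_ne_zero

/-- Exterior multiplication by the element `c` of the dual of `E` is a homotopy on the Koszul
complex between zero and multiplication by the corresponding element of `S`. -/
theorem koszul_wedge (c : E →ₗ[k] k) {n : ℕ} (y : E [⋀^Fin (n + 1)]→ₗ[k] M)
    (hy : koszul e x y = 0) :
    koszul e x (AlternatingMap.alternatizeUncurryFin (c.smulRight y)) =
      (Algebra.lsmul k k M (∑ b, c (e b) • x b)).compAlternatingMap y := by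
  ext v
  have h : ∀ b, (AlternatingMap.alternatizeUncurryFin (c.smulRight y)) (Matrix.vecCons (e b) v) =
      c (e b) • y v - ∑ i : Fin (n + 1), (-1) ^ (i : ℕ) •
        c (v i) • y (Matrix.vecCons (e b) (i.removeNth v)) := by
    intro b
    rw [AlternatingMap.alternatizeUncurryFin_apply, Fin.sum_univ_succ, sub_eq_add_neg,
      ← Finset.sum_neg_distrib]
    congr 1
    · simp [Matrix.vecCons]
    · refine Finset.sum_congr rfl fun i _ => ?_
      have : (i.succ).removeNth (Matrix.vecCons (e b) v) =
          Matrix.vecCons (e b) (i.removeNth v) := by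
        funext j
        refine Fin.cases ?_ (fun j => ?_) j <;> simp [Fin.removeNth, Matrix.vecCons]
      rw [this]
      simp [pow_succ, Matrix.vecCons]
  have h0 : ∀ i : Fin (n + 1), ∑ b, x b • y (Matrix.vecCons (e b) (i.removeNth v)) = 0 := by
    intro i
    rw [← koszul_apply, hy]; rfl
  rw [koszul_apply]
  simp only [h, smul_sub, Finset.sum_sub_distrib, Finset.smul_sum]
  rw [Finset.sum_comm (t := (Finset.univ : Finset (Fin (n + 1))))]
  have : ∑ i : Fin (n + 1), ∑ b, x b • (-1) ^ (i : ℕ) • c (v i) •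
      y (Matrix.vecCons (e b) (i.removeNth v)) = 0 := by
    refine Finset.sum_eq_zero fun i _ => ?_
    have := congrArg (fun m => ((-1 : ℤ) ^ (i : ℕ)) • c (v i) • m) (h0 i)
    simp only [smul_zero, Finset.smul_sum] at this
    rw [← this]
    refine Finset.sum_congr rfl fun b _ => ?_
    rw [smul_comm (x b), smul_comm (x b)]
  rw [this, sub_zero]
  simp only [LinearMap.compAlternatingMap_apply, Algebra.lsmul_coe, Finset.sum_smul, smul_assoc]
  exact Finset.sum_congr rfl fun b _ => smul_comm _ _ _

/-- The homotopy attached to operators `P b` that behave as partial derivatives in the `x b`. -/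
noncomputable def koszulHomotopy (q : κ → E →ₗ[k] k) (P : κ → M →ₗ[k] M) {n : ℕ}
    (y : E [⋀^Fin n]→ₗ[k] M) : E [⋀^Fin (n + 1)]→ₗ[k] M :=
  AlternatingMap.alternatizeUncurryFin (∑ b, (q b).smulRight ((P b).compAlternatingMap y))

theorem koszulHomotopy_apply (q : κ → E →ₗ[k] k) (P : κ → M →ₗ[k] M) {n : ℕ}
    (y : E [⋀^Fin n]→ₗ[k] M) (v : Fin (n + 1) → E) :
    koszulHomotopy q P y v =
      ∑ i : Fin (n + 1), (-1) ^ (i : ℕ) • ∑ b, q b (v i) • P b (y (i.removeNth v)) := by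
  simp [koszulHomotopy, AlternatingMap.alternatizeUncurryFin_apply, alternatingMap_sum_apply]

theorem koszulHomotopy_vecCons [DecidableEq κ] (q : κ → E →ₗ[k] k)
    (hq : ∀ b c, q b (e c) = if b = c then 1 else 0)
    (P : κ → M →ₗ[k] M) {n : ℕ} (y : E [⋀^Fin (n + 1)]→ₗ[k] M) (b : κ) (v : Fin (n + 1) → E) :
    koszulHomotopy q P y (Matrix.vecCons (e b) v) = P b (y v) -
      ∑ i : Fin (n + 1), (-1) ^ (i : ℕ) •
        ∑ c, q c (v i) • P c (y (Matrix.vecCons (e b) (i.removeNth v))) := by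
  rw [koszulHomotopy_apply, Fin.sum_univ_succ, sub_eq_add_neg, ← Finset.sum_neg_distrib]
  congr 1
  · simp [Matrix.vecCons, hq]
  · refine Finset.sum_congr rfl fun i _ => ?_
    have : (i.succ).removeNth (Matrix.vecCons (e b) v) =
        Matrix.vecCons (e b) (i.removeNth v) := by
      funext j
      refine Fin.cases ?_ (fun j => ?_) j <;> simp [Fin.removeNth, Matrix.vecCons]
    rw [this]
    simp [pow_succ, Matrix.vecCons]

/-- On a module with partial derivatives the Koszul complex is contracted by the Euler operator. -/
theorem koszul_koszulHomotopy [DecidableEq κ] (q : κ → E →ₗ[k] k)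
    (hq : ∀ b c, q b (e c) = if b = c then 1 else 0) (hqe : ∀ v, ∑ b, q b v • e b = v)
    (P : κ → M →ₗ[k] M) (hP : ∀ b c m, P b (x c • m) = (if b = c then m else 0) + x c • P b m)
    {n : ℕ} (y : E [⋀^Fin (n + 1)]→ₗ[k] M) (hy : koszul e x y = 0) (v : Fin (n + 1) → E) :
    koszul e x (koszulHomotopy q P y) v =
      (∑ b, x b • P b (y v)) + (n + 1 : k) • y v := by
  rw [koszul_apply]
  simp only [koszulHomotopy_vecCons e q hq, smul_sub, Finset.sum_sub_distrib]
  rw [sub_eq_add_neg]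
  congr 1
  -- apply `P c` to the equation `koszul e x y = 0`
  have h0 : ∀ (i : Fin (n + 1)) (c : κ),
      ∑ b, x b • P c (y (Matrix.vecCons (e b) (i.removeNth v))) =
        - y (Matrix.vecCons (e c) (i.removeNth v)) := by
    intro i c
    have h : koszul e x y (i.removeNth v) = 0 := by rw [hy]; rfl
    have h' := congrArg (P c) h
    rw [koszul_apply, map_sum, map_zero] at h'
    simp only [hP, Finset.sum_add_distrib, Finset.sum_ite_eq, Finset.mem_univ, if_true] at h'
    exact eq_neg_of_add_eq_zero_right h'
  have h1 : ∀ i : Fin (n + 1), (-1) ^ (i : ℕ) •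
      ∑ c, q c (v i) • y (Matrix.vecCons (e c) (i.removeNth v)) = y v := by
    intro i
    have : ∑ c, q c (v i) • y (Matrix.vecCons (e c) (i.removeNth v)) =
        y (Matrix.vecCons (v i) (i.removeNth v)) := by
      conv_rhs => rw [← hqe (v i)]
      have h := map_sum (y.curryLeft) (fun c => q c (v i) • e c) Finset.univ
      have h := congrArg (fun f => f (i.removeNth v)) h
      simp only [AlternatingMap.curryLeft_apply_apply, alternatingMap_sum_apply, map_smul,
        AlternatingMap.smul_apply] at h
      exact h.symm
    rw [this, ← AlternatingMap.map_insertNth]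
    simp
  have h2 : ∑ b, x b • ∑ i : Fin (n + 1), (-1) ^ (i : ℕ) •
      ∑ c, q c (v i) • P c (y (Matrix.vecCons (e b) (i.removeNth v))) =
      ∑ i : Fin (n + 1), (-1) ^ (i : ℕ) • ∑ c, q c (v i) •
        ∑ b, x b • P c (y (Matrix.vecCons (e b) (i.removeNth v))) := by
    simp only [Finset.smul_sum]
    rw [Finset.sum_comm]
    refine Finset.sum_congr rfl fun i _ => ?_
    rw [Finset.sum_comm]
    refine Finset.sum_congr rfl fun c _ => Finset.sum_congr rfl fun b _ => ?_
    rw [smul_comm (x b), smul_comm (x b)]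
  rw [h2]
  simp only [h0, smul_neg, Finset.sum_neg_distrib, neg_neg, h1]
  simp [← Nat.cast_smul_eq_nsmul k]

theorem koszul_koszulHomotopy_zero [DecidableEq κ] (q : κ → E →ₗ[k] k)
    (hq : ∀ b c, q b (e c) = if b = c then 1 else 0)
    (P : κ → M →ₗ[k] M) (y : E [⋀^Fin 0]→ₗ[k] M) (v : Fin 0 → E) :
    koszul e x (koszulHomotopy q P y) v = ∑ b, x b • P b (y v) := by
  rw [koszul_apply]
  refine Finset.sum_congr rfl fun b _ => ?_
  rw [koszulHomotopy_apply]
  simp [Matrix.vecCons, hq, Subsingleton.elim _ v]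

end Koszul

/-! ### Derivatives and the Euler operator on the symmetric algebra -/

section SymmetricOperators

variable {k : Type*} [Field k] {W : Type*} [AddCommGroup W] [Module k W]
  {κ : Type*} (b : Module.Basis κ k W)

/-- The partial derivative of `Sym(W)` in the direction of a basis element of `W`. -/
noncomputable def symDeriv (c : κ) : SymmetricAlgebra k W →ₗ[k] SymmetricAlgebra k W :=
  (SymmetricAlgebra.equivMvPolynomial b).symm.toLinearMap ∘ₗ
    (MvPolynomial.pderiv c).toLinearMap ∘ₗ (SymmetricAlgebra.equivMvPolynomial b).toLinearMap

theorem symDeriv_ι_mul (c : κ) (w : W) (s : SymmetricAlgebra k W) :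
    symDeriv b c (SymmetricAlgebra.ι k W w * s) =
      b.coord c w • s + SymmetricAlgebra.ι k W w * symDeriv b c s := by
  classical
  have key : ∀ c', symDeriv b c (SymmetricAlgebra.ι k W (b c') * s) =
      b.coord c (b c') • s + SymmetricAlgebra.ι k W (b c') * symDeriv b c s := by
    intro c'
    simp only [symDeriv, LinearMap.comp_apply, AlgEquiv.toLinearMap_apply, map_mul,
      SymmetricAlgebra.equivMvPolynomial_ι_apply, Derivation.coeFn_coe, Derivation.leibniz,
      MvPolynomial.pderiv_X, smul_eq_mul, map_add,
      SymmetricAlgebra.equivMvPolynomial_symm_X, AlgEquiv.symm_apply_apply,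
      Module.Basis.coord_apply, Module.Basis.repr_self]
    rw [add_comm]
    congr 1
    by_cases h : c' = c
    · subst h; simp
    · simp [h, Ne.symm h]
  have hlin : (symDeriv b c) ∘ₗ (LinearMap.mulRight k s) ∘ₗ SymmetricAlgebra.ι k W =
      (b.coord c).smulRight s +
        (LinearMap.mulRight k (symDeriv b c s)) ∘ₗ SymmetricAlgebra.ι k W :=
    b.ext fun c' => by simpa using key c'
  simpa using LinearMap.congr_fun hlin w

theorem symDeriv_algebraMap (c : κ) (a : k) : symDeriv b c (algebraMap k _ a) = 0 := by
  simp [symDeriv]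

/-- Euler's formula. -/
theorem sum_mul_symDeriv [Fintype κ] (n : ℕ) (s : SymmetricAlgebra k W) (hs : s ∈ symPow k W n) :
    ∑ c, SymmetricAlgebra.ι k W (b c) * symDeriv b c s = (n : k) • s := by
  unfold symPow at hs
  induction hs using Submodule.pow_induction_on_left' with
  | algebraMap r => simp [symDeriv_algebraMap]
  | add x y i hx hy ihx ihy => simp only [map_add, mul_add, Finset.sum_add_distrib, ihx, ihy,
      smul_add]
  | mem_mul m hm i x hx ih =>
    obtain ⟨w, rfl⟩ := hm
    simp only [symDeriv_ι_mul, mul_add, Finset.sum_add_distrib]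
    have h1 : ∑ c, SymmetricAlgebra.ι k W (b c) * b.coord c w • x =
        SymmetricAlgebra.ι k W w * x := by
      conv_rhs => rw [← b.sum_repr w]
      rw [map_sum, Finset.sum_mul]
      refine Finset.sum_congr rfl fun c _ => ?_
      simp
    have h2 : ∑ c, SymmetricAlgebra.ι k W (b c) * (SymmetricAlgebra.ι k W w * symDeriv b c x) =
        (i : k) • (SymmetricAlgebra.ι k W w * x) := by
      rw [← mul_smul_comm, ← ih, Finset.mul_sum]
      exact Finset.sum_congr rfl fun c _ => mul_left_comm _ _ _
    rw [h1, h2, Nat.cast_succ, add_smul, one_smul, add_comm]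

variable (k W) in
/-- The operator on `Sym(W)` that divides the component of degree `e` by `e + j`, with the junk
value zero on the component of degree zero if `j = 0`. -/
noncomputable def symInv (j : ℕ) : SymmetricAlgebra k W →ₗ[k] SymmetricAlgebra k W :=
  DirectSum.toModule k ℕ _ (fun e => ((e + j : ℕ) : k)⁻¹ • (symPow k W e).subtype) ∘ₗ
    (DirectSum.decomposeLinearEquiv (symPow k W)).toLinearMap

theorem symInv_of_mem (j e : ℕ) (s : SymmetricAlgebra k W) (hs : s ∈ symPow k W e) :
    symInv k W j s = ((e + j : ℕ) : k)⁻¹ • s := by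
  lift s to symPow k W e using hs
  rw [symInv, LinearMap.comp_apply, LinearEquiv.coe_coe, DirectSum.decomposeLinearEquiv_apply,
    DirectSum.decompose_coe]
  exact (DirectSum.toModule_lof (M := fun e => symPow k W e) k e s).trans rfl

theorem ι_mul_symInv (j : ℕ) (w : W) (s : SymmetricAlgebra k W) :
    SymmetricAlgebra.ι k W w * symInv k W (j + 1) s =
      symInv k W j (SymmetricAlgebra.ι k W w * s) := by
  induction s using DirectSum.Decomposition.inductionOn (symPow k W) with
  | zero => simp
  | @homogeneous e s =>
    rw [symInv_of_mem _ e _ s.2, symInv_of_mem _ (1 + e) _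
      (SetLike.mul_mem_graded (ι_mem_symPow k W w) s.2), mul_smul_comm,
      show 1 + e + j = e + (j + 1) by omega]
  | add s t hs ht => simp only [map_add, mul_add, hs, ht]

theorem euler_symInv [CharZero k] [Fintype κ] (j : ℕ) (s : SymmetricAlgebra k W) :
    ∑ c, SymmetricAlgebra.ι k W (b c) * symDeriv b c (symInv k W (j + 1) s) +
      (j + 1 : k) • symInv k W (j + 1) s = s := by
  induction s using DirectSum.Decomposition.inductionOn (symPow k W) with
  | zero => simp
  | @homogeneous e s =>
    rw [symInv_of_mem _ e _ s.2, sum_mul_symDeriv b e _ (Submodule.smul_mem _ _ s.2), ← add_smul,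
      smul_smul]
    have : ((e : k) + (j + 1)) ≠ 0 := by exact_mod_cast Nat.succ_ne_zero (e + j)
    push_cast
    rw [mul_inv_cancel₀ this, one_smul]
  | add s t hs ht =>
    conv_rhs => rw [← hs, ← ht]
    simp only [map_add, mul_add, Finset.sum_add_distrib, smul_add]
    abel

theorem euler_symInv_zero [CharZero k] [Fintype κ] (s : SymmetricAlgebra k W) :
    ∑ c, SymmetricAlgebra.ι k W (b c) * symDeriv b c (symInv k W 0 s) =
      s - GradedAlgebra.proj (symPow k W) 0 s := by
  induction s using DirectSum.Decomposition.inductionOn (symPow k W) with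
  | zero => simp
  | @homogeneous e s =>
    rw [symInv_of_mem _ e _ s.2, sum_mul_symDeriv b e _ (Submodule.smul_mem _ _ s.2),
      smul_smul, GradedAlgebra.proj_apply]
    rcases Nat.eq_zero_or_pos e with rfl | he
    · rw [DirectSum.decompose_of_mem_same _ s.2]; simp
    · rw [DirectSum.decompose_of_mem_ne _ s.2 he.ne', sub_zero, add_zero,
        mul_inv_cancel₀ (by exact_mod_cast he.ne'), one_smul]
  | add s t hs ht =>
    simp only [map_add, mul_add, Finset.sum_add_distrib, hs, ht]
    abel

theorem eval_coord [DecidableEq κ] (c c' : κ) :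
    Module.Dual.eval k W (b c) (b.coord c') = if c = c' then 1 else 0 := by
  simp [Finsupp.single_apply]

theorem finsupp_symDeriv {G : Type*} [DecidableEq κ] (c c' : κ) (f : G →₀ SymmetricAlgebra k W) :
    Finsupp.mapRange.linearMap (symDeriv b c) (SymmetricAlgebra.ι k W (b c') • f) =
      (if c = c' then f else 0) + SymmetricAlgebra.ι k W (b c') •
        Finsupp.mapRange.linearMap (symDeriv b c) f := by
  ext a
  simp only [Finsupp.mapRange.linearMap_apply, Finsupp.mapRange_apply, Finsupp.smul_apply,
    smul_eq_mul, symDeriv_ι_mul, Finsupp.add_apply, Module.Basis.coord_apply,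
    Module.Basis.repr_self, Finsupp.single_apply]
  congr 1
  by_cases h : c = c'
  · simp [h]
  · simp [h, Ne.symm h]

end SymmetricOperators

/-! ### Exactness of the Koszul complex of a free module -/

section Exactness

variable {k : Type*} [Field k] {W : Type*} [AddCommGroup W] [Module k W]
  {κ : Type*} [Fintype κ] (b : Module.Basis κ k W)
  {M : Type*} [AddCommGroup M] [Module k M] [Module (SymmetricAlgebra k W) M]
  [IsScalarTower k (SymmetricAlgebra k W) M]

/-- The Koszul differential of a module over `Sym(W)`. -/
noncomputable abbrev symKoszul {n : ℕ} (y : Module.Dual k W [⋀^Fin (n + 1)]→ₗ[k] M) :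
    Module.Dual k W [⋀^Fin n]→ₗ[k] M :=
  koszul b.coord (fun c => SymmetricAlgebra.ι k W (b c)) y

/-- The cycles of the Koszul complex of a module over `Sym(W)`; in exterior degree zero every
element is a cycle. -/
def IsKoszulCycle : {n : ℕ} → (Module.Dual k W [⋀^Fin n]→ₗ[k] M) → Prop
  | 0, _ => True
  | _ + 1, y => symKoszul b y = 0

variable {G : Type*}

/-- The Koszul complex of a free module is exact in positive exterior degrees. -/
theorem exists_symKoszul_eq_of_free [CharZero k] {n : ℕ}
    (y : Module.Dual k W [⋀^Fin (n + 1)]→ₗ[k] (G →₀ SymmetricAlgebra k W))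
    (hy : symKoszul b y = 0) : ∃ z, symKoszul b z = y := by
  classical
  -- `symInv` inverts the Euler operator and preserves cycles
  let y' := (Finsupp.mapRange.linearMap (symInv k W (n + 1)) :
    (G →₀ SymmetricAlgebra k W) →ₗ[k] _).compAlternatingMap y
  have hy' : symKoszul b y' = 0 := by
    ext v a
    have h := congrArg (fun z => Finsupp.mapRange.linearMap (symInv k W n) (z v)) hy
    have h := DFunLike.congr_fun h a
    simp only [koszul_apply, map_sum, Finsupp.coe_finsetSum, Finset.sum_apply,
      Finsupp.mapRange.linearMap_apply, Finsupp.mapRange_apply, Finsupp.smul_apply,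
      smul_eq_mul] at h
    simp only [koszul_apply, Finsupp.coe_finsetSum, Finset.sum_apply, Finsupp.smul_apply,
      smul_eq_mul, y', LinearMap.compAlternatingMap_apply, Finsupp.mapRange.linearMap_apply,
      Finsupp.mapRange_apply, ι_mul_symInv]
    rw [h]
    simp
  refine ⟨koszulHomotopy (fun c => Module.Dual.eval k W (b c))
    (fun c => Finsupp.mapRange.linearMap (symDeriv b c)) y', ?_⟩
  ext v a
  rw [symKoszul, koszul_koszulHomotopy _ _ _ (eval_coord b)
    (fun v => b.sum_dual_apply_smul_coord v) _ (finsupp_symDeriv b) y' hy' v]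
  conv_rhs => rw [← euler_symInv b n (y v a)]
  simp [y']

/-- In exterior degree zero the boundaries in the Koszul complex of a free module are the elements
whose coordinates have no constant term. -/
theorem exists_symKoszul_eq_of_irrelevant [CharZero k]
    (y : Module.Dual k W [⋀^Fin 0]→ₗ[k] (G →₀ SymmetricAlgebra k W))
    (hy : ∀ v a, y v a ∈ (HomogeneousIdeal.irrelevant (symPow k W)).toIdeal) :
    ∃ z, symKoszul b z = y := by
  classical
  let y' := (Finsupp.mapRange.linearMap (symInv k W 0) :
    (G →₀ SymmetricAlgebra k W) →ₗ[k] _).compAlternatingMap y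
  refine ⟨koszulHomotopy (fun c => Module.Dual.eval k W (b c))
    (fun c => Finsupp.mapRange.linearMap (symDeriv b c)) y', ?_⟩
  ext v a
  rw [symKoszul, koszul_koszulHomotopy_zero _ _ _ (eval_coord b)]
  have h := euler_symInv_zero b (y v a)
  have h0 : GradedAlgebra.proj (symPow k W) 0 (y v a) = 0 := hy v a
  rw [h0, sub_zero] at h
  conv_rhs => rw [← h]
  simp [y']

end Exactness

/-! ### Tor and Koszul homology -/

section Lifting

variable {k : Type*} [Field k] {E : Type*} [AddCommGroup E] [Module k E]
  {A : Type*} [AddCommGroup A] [Module k A] {B : Type*} [AddCommGroup B] [Module k B]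

theorem exists_compAlternatingMap_eq (φ : A →ₗ[k] B) {n : ℕ} (y : E [⋀^Fin n]→ₗ[k] B)
    (hy : ∀ v, y v ∈ LinearMap.range φ) : ∃ z, φ.compAlternatingMap z = y := by
  obtain ⟨σ, hσ⟩ := φ.rangeRestrict.exists_rightInverse_of_surjective φ.range_rangeRestrict
  refine ⟨σ.compAlternatingMap (y.codRestrict _ hy), ?_⟩
  ext v
  exact congrArg Subtype.val (LinearMap.congr_fun hσ (y.codRestrict _ hy v))

end Lifting

section Chase

variable {k : Type*} [Field k] {W : Type*} [AddCommGroup W] [Module k W]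
  {κ : Type*} [Fintype κ] (b : Module.Basis κ k W)

theorem freeProj_succ_ι_smul {G : Type _} (deg : G → ℕ) (m : ℕ) (w : W)
    (f : G →₀ SymmetricAlgebra k W) :
    freeProj (symPow k W) deg (m + 1) (SymmetricAlgebra.ι k W w • f) =
      SymmetricAlgebra.ι k W w • freeProj (symPow k W) deg m f := by
  ext a
  rw [Finsupp.smul_apply, freeProj_apply, freeProj_apply, Finsupp.smul_apply, smul_eq_mul]
  by_cases h : deg a ≤ m
  · rw [if_pos (by omega), if_pos h, show m + 1 - deg a = m - deg a + 1 by omega]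
    exact congrArg Subtype.val (symProj_succ_ι_mul w (m - deg a) (f a))
  · rw [if_neg h, smul_zero]
    split
    · rw [show m + 1 - deg a = 0 by omega]
      exact congrArg Subtype.val (symProj_zero_ι_mul w (f a))
    · rfl

theorem freeProj_symKoszul {G : Type _} (deg : G → ℕ) (m : ℕ) {n : ℕ}
    (y : Module.Dual k W [⋀^Fin (n + 1)]→ₗ[k] (G →₀ SymmetricAlgebra k W)) :
    (freeProj (symPow k W) deg (m + 1)).compAlternatingMap (symKoszul b y) =
      symKoszul b ((freeProj (symPow k W) deg m).compAlternatingMap y) := by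
  ext1 v
  simp only [LinearMap.compAlternatingMap_apply, koszul_apply, map_sum, freeProj_succ_ι_smul]

namespace GradedFreeResolution

variable {M : Type*} [AddCommGroup M] [Module (SymmetricAlgebra k W) M] [Module k M]
  {ℳ : ℕ → Submodule k M} (F : GradedFreeResolution (symPow k W) ℳ)

theorem freeProj_d (n m : ℕ) (f : F.gen (n + 1) →₀ SymmetricAlgebra k W) :
    freeProj (symPow k W) (F.deg n) m (F.d n f) =
      F.d n (freeProj (symPow k W) (F.deg (n + 1)) m f) := by
  obtain ⟨N, hN⟩ := sum_freeProj (symPow k W) (F.deg (n + 1)) f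
  conv_lhs => rw [← hN (max N (m + 1)) (le_max_left _ _)]
  rw [map_sum, map_sum]
  simp only [freeProj_of_mem _ (F.deg n) m _ _ (F.d_mem n _ _ (freeProj_mem _ _ _ _))]
  rw [Finset.sum_ite_eq, if_pos (Finset.mem_range.2 (by omega))]

theorem mem_irrelevant_of_tmul_eq_zero {G : Type*} (f : G →₀ SymmetricAlgebra k W)
    (hf : (1 : ResidueRing (symPow k W)) ⊗ₜ[SymmetricAlgebra k W] f = 0) (a : G) :
    f a ∈ (HomogeneousIdeal.irrelevant (symPow k W)).toIdeal := by
  let φ : ResidueRing (symPow k W) ⊗[SymmetricAlgebra k W] (G →₀ SymmetricAlgebra k W)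
      →ₗ[SymmetricAlgebra k W] ResidueRing (symPow k W) :=
    (TensorProduct.rid (SymmetricAlgebra k W) (ResidueRing (symPow k W))).toLinearMap ∘ₗ
      (Finsupp.lapply a).lTensor (ResidueRing (symPow k W))
  have h : φ (1 ⊗ₜ f) = f a • (1 : ResidueRing (symPow k W)) := by
    simp only [φ, LinearMap.comp_apply, LinearMap.lTensor_tmul, LinearEquiv.coe_coe,
      TensorProduct.rid_tmul, Finsupp.lapply_apply]
  rw [hf, LinearMap.map_zero φ, Algebra.smul_def, mul_one] at h
  exact Ideal.Quotient.eq_zero_iff_mem.1 h.symm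

theorem ι_smul_tmul {G : Type*} (w : W) (f : G →₀ SymmetricAlgebra k W) :
    (1 : ResidueRing (symPow k W)) ⊗ₜ[SymmetricAlgebra k W] (SymmetricAlgebra.ι k W w • f) = 0 := by
  have h : SymmetricAlgebra.ι k W w • (1 : ResidueRing (symPow k W)) = 0 := by
    rw [Algebra.smul_def, mul_one]
    refine Ideal.Quotient.eq_zero_iff_mem.2 ?_
    change GradedAlgebra.proj (symPow k W) 0 _ = 0
    rw [GradedAlgebra.proj_apply, DirectSum.decompose_of_mem_ne _ (ι_mem_symPow k W w) one_ne_zero]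
  rw [← TensorProduct.smul_tmul, h, TensorProduct.zero_tmul]

variable [IsScalarTower k (SymmetricAlgebra k W) M]

/-- An element of the double complex formed by the Koszul complexes of the terms of a resolution is
a lifted cycle if its image under the differential of the resolution is a Koszul boundary, or, in
the column of the augmentation, if its image under the augmentation is a Koszul cycle. -/
def IsLiftedCycle : (n : ℕ) → {j : ℕ} →
    (Module.Dual k W [⋀^Fin j]→ₗ[k] (F.gen n →₀ SymmetricAlgebra k W)) → Prop
  | 0, _, y => IsKoszulCycle b ((F.aug.restrictScalars k).compAlternatingMap y)
  | n + 1, _, y => ∃ z, ((F.d n).restrictScalars k).compAlternatingMap y = symKoszul b z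

/-- The diagram chase in the double complex formed by the Koszul complexes of the terms of a
resolution: if the Koszul homology of the resolved module vanishes in exterior degree `i` and
total degree `m`, then so does the homology of the resolution modulo the variables. -/
theorem exists_eq_koszul_add_d [CharZero k] {i m : ℕ} (him : i ≤ m)
    (H : ∀ y : Module.Dual k W [⋀^Fin i]→ₗ[k] M, IsKoszulCycle b y →
      (∀ v, y v ∈ ℳ (m - i)) → ∃ z, symKoszul b z = y) (n : ℕ) :
    ∀ j, n + j = i → ∀ y : Module.Dual k W [⋀^Fin j]→ₗ[k] (F.gen n →₀ SymmetricAlgebra k W),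
      (∀ v, y v ∈ freePart (symPow k W) (F.deg n) (m - j)) → F.IsLiftedCycle b n y →
      ∃ z t, y = symKoszul b z + ((F.d n).restrictScalars k).compAlternatingMap t := by
  induction n with
  | zero =>
    intro j hj y hy hc
    obtain rfl : j = i := by omega
    obtain ⟨z, hz⟩ := H _ hc fun v => F.aug_mem _ _ (hy v)
    obtain ⟨z', rfl⟩ := exists_compAlternatingMap_eq (F.aug.restrictScalars k) z
      fun v => F.aug_surjective (z v)
    obtain ⟨t, ht⟩ := exists_compAlternatingMap_eq ((F.d 0).restrictScalars k)
      (y - symKoszul b z') fun v => by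
        refine (F.exact_aug _).1 ?_
        have h := congrArg (fun f => f v) hz
        rw [symKoszul, koszul_comp] at h
        rw [AlternatingMap.sub_apply, map_sub, sub_eq_zero]
        exact h.symm
    exact ⟨z', t, by rw [ht]; abel⟩
  | succ n ih =>
    rintro j hj y hy ⟨z, hz⟩
    -- the projection of `z` to the degree that the equation asks for
    obtain ⟨e, he⟩ : ∃ e, m - j = e + 1 := ⟨m - j - 1, by omega⟩
    let z' := (freeProj (symPow k W) (F.deg n) e).compAlternatingMap z
    have hz' : ((F.d n).restrictScalars k).compAlternatingMap y = symKoszul b z' := by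
      rw [← freeProj_symKoszul, ← hz]
      ext1 v
      refine ((freeProj_of_mem _ _ (e + 1) (e + 1) _ ?_).trans (if_pos rfl)).symm
      rw [← he]
      exact F.d_mem _ _ _ (hy v)
    have hzc : F.IsLiftedCycle b n z' := by
      cases n with
      | zero =>
        change symKoszul b _ = 0
        rw [symKoszul, koszul_comp]
        unfold symKoszul at hz'
        rw [← hz']
        ext1 v
        exact (F.exact_aug _).2 ⟨y v, rfl⟩
      | succ n =>
        have : symKoszul b (((F.d n).restrictScalars k).compAlternatingMap z') = 0 := by
          rw [symKoszul, koszul_comp]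
          unfold symKoszul at hz'
          rw [← hz']
          ext1 v
          exact (F.exact n _).2 ⟨y v, rfl⟩
        obtain ⟨t, ht⟩ := exists_symKoszul_eq_of_free b _ this
        exact ⟨t, ht.symm⟩
    obtain ⟨s, t, hst⟩ := ih (j + 1) (by omega) z' (fun v => by
      rw [show m - (j + 1) = e by omega]; exact freeProj_mem _ _ _ _) hzc
    obtain ⟨r, hr⟩ := exists_compAlternatingMap_eq ((F.d (n + 1)).restrictScalars k)
      (y - symKoszul b t) fun v => by
        refine (F.exact n _).1 ?_
        have h : ((F.d n).restrictScalars k).compAlternatingMap y =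
            ((F.d n).restrictScalars k).compAlternatingMap (symKoszul b t) := by
          rw [hz', hst, symKoszul, koszul_add, koszul_koszul, zero_add, koszul_comp]
        have h := congrArg (fun f => f v) h
        rw [AlternatingMap.sub_apply, map_sub, sub_eq_zero]
        exact h
    exact ⟨t, r, by rw [hr]; abel⟩

/-- `Tor` vanishes in degree `m` as soon as the Koszul homology does. An element of exterior degree
`i` and total degree `m` has values of degree `m - i`. -/
theorem tor_eq_bot [CharZero k] {i m : ℕ} (him : i ≤ m) (hm : 0 < m)
    (H : ∀ y : Module.Dual k W [⋀^Fin i]→ₗ[k] M, IsKoszulCycle b y →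
      (∀ v, y v ∈ ℳ (m - i)) → ∃ z, symKoszul b z = y) : F.Tor i m = ⊥ := by
  rw [Tor, ← le_bot_iff, Submodule.map_le_iff_le_comap, ← LinearMap.ker, Submodule.ker_mkQ]
  -- a cycle `1 ⊗ f` is a boundary, by the chase in exterior degree zero
  intro τ hτ
  have hpart : τ ∈ F.termPart i m := by
    cases i with
    | zero => exact hτ
    | succ i => exact hτ.1
  obtain ⟨f, hf, rfl⟩ := hpart
  have hf' : ∀ v, AlternatingMap.constOfIsEmpty k (Module.Dual k W) (Fin 0) f v ∈
      freePart (symPow k W) (F.deg i) (m - 0) := fun _ => hf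
  obtain ⟨z, t, hzt⟩ := F.exists_eq_koszul_add_d b him H i 0 (add_zero i)
    (AlternatingMap.constOfIsEmpty k (Module.Dual k W) (Fin 0) f) hf' (by
      cases i with
      | zero => trivial
      | succ i =>
        have h : (1 : ResidueRing (symPow k W)) ⊗ₜ[SymmetricAlgebra k W] F.d i f = 0 := hτ.2
        obtain ⟨z, hz⟩ := exists_symKoszul_eq_of_irrelevant b
          (((F.d i).restrictScalars k).compAlternatingMap
            (AlternatingMap.constOfIsEmpty k (Module.Dual k W) (Fin 0) f))
          fun _ a => mem_irrelevant_of_tmul_eq_zero _ h a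
        exact ⟨z, hz.symm⟩)
  -- the degree `m` part of the equation; the Koszul boundary vanishes modulo the variables
  have h := congrArg (fun y => freeProj (symPow k W) (F.deg i) m (y ![])) hzt
  simp only [AlternatingMap.constOfIsEmpty_apply, AlternatingMap.add_apply, map_add,
    LinearMap.compAlternatingMap_apply, LinearMap.coe_restrictScalars, freeProj_d] at h
  rw [Function.const_apply, freeProj_of_mem _ _ m m f hf, if_pos rfl] at h
  refine ⟨(1 : ResidueRing (symPow k W)) ⊗ₜ[SymmetricAlgebra k W]
    freeProj (symPow k W) (F.deg (i + 1)) m (t ![]), ⟨_, freeProj_mem _ _ _ _, rfl⟩, ?_⟩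
  change (1 : ResidueRing (symPow k W)) ⊗ₜ[SymmetricAlgebra k W] F.d i _ = 1 ⊗ₜ f
  conv_rhs => rw [h]
  obtain ⟨m', rfl⟩ : ∃ m', m = m' + 1 := ⟨m - 1, by omega⟩
  rw [koszul_apply, map_sum]
  simp only [freeProj_succ_ι_smul, TensorProduct.tmul_add, TensorProduct.tmul_sum, ι_smul_tmul,
    Finset.sum_const_zero, zero_add]

end GradedFreeResolution

end Chase

/-! ### Words and Gröbner bases -/

section Words

/-- A letter: the exponent of a monomial in `N` variables, and either no marker or one of `i`
markers. -/
abbrev Letter (N i : ℕ) : Type := (Fin N → ℕ) × Option (Fin i)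

variable {N i : ℕ}

/-- Letterwise multiplication of a word by monomials. -/
def shiftWord {n : ℕ} (a : Fin n → Fin N → ℕ) (w : Fin n → Letter N i) : Fin n → Letter N i :=
  fun p => ((w p).1 + a p, (w p).2)

/-- Insertion of an unmarked letter in a word. -/
def insertWord {n : ℕ} (p : Fin (n + 1)) (a : Fin N → ℕ) (w : Fin n → Letter N i) :
    Fin (n + 1) → Letter N i :=
  Fin.insertNth (α := fun _ => Letter N i) p (a, none) w

/-- A word of length `n` in letters of degree `d` in which every marker occurs exactly once. -/
structure IsMarkedWord (d n : ℕ) (w : Fin n → Letter N i) : Prop where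
  degree : ∀ p, ∑ x, (w p).1 x = d
  marker : ∀ l, ∃! p, (w p).2 = some l

/-- The total order on letters that is used to compare words: first by exponents, which makes it
compatible with multiplication, then by markers, with the unmarked letters lowest. -/
def letterKey (l : Letter N i) : Lex (Fin N → ℕ) ×ₗ WithBot (Fin i) :=
  toLex (toLex l.1, (l.2 : WithBot (Fin i)))

/-- Words of the same length are ordered lexicographically. -/
def wordKey {n : ℕ} (w : Fin n → Letter N i) :
    Lex (Fin n → Lex (Fin N → ℕ) ×ₗ WithBot (Fin i)) :=
  toLex fun p => letterKey (w p)

theorem letterKey_injective : Function.Injective (letterKey (N := N) (i := i)) := by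
  rintro ⟨a, o⟩ ⟨a', o'⟩ h
  have h' := toLex.injective h
  exact Prod.ext (toLex.injective (congrArg Prod.fst h')) (congrArg Prod.snd h')

theorem wordKey_injective {n : ℕ} : Function.Injective (wordKey (N := N) (i := i) (n := n)) := by
  intro w w' h
  funext p
  exact letterKey_injective (congrFun (toLex.injective h) p)

theorem wordKey_lt_iff {n : ℕ} (w w' : Fin n → Letter N i) :
    wordKey w < wordKey w' ↔
      ∃ p, (∀ q < p, w q = w' q) ∧ letterKey (w p) < letterKey (w' p) := by
  refine exists_congr fun p => and_congr (forall_congr' fun q => forall_congr' fun _ => ?_) Iff.rfl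
  exact letterKey_injective.eq_iff

theorem letterKey_shift_lt {l l' : Letter N i} (a : Fin N → ℕ) (h : letterKey l < letterKey l') :
    letterKey (l.1 + a, l.2) < letterKey (l'.1 + a, l'.2) := by
  rw [letterKey, letterKey, Prod.Lex.toLex_lt_toLex] at h ⊢
  rcases h with h | ⟨h, h'⟩
  · exact Or.inl (add_lt_add_left h (toLex a))
  · exact Or.inr ⟨congrArg (· + toLex a) h, h'⟩

theorem wordKey_shiftWord_lt {n : ℕ} (a : Fin n → Fin N → ℕ) {w w' : Fin n → Letter N i}
    (h : wordKey w < wordKey w') : wordKey (shiftWord a w) < wordKey (shiftWord a w') := by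
  rw [wordKey_lt_iff] at h ⊢
  obtain ⟨p, hp, hlt⟩ := h
  exact ⟨p, fun q hq => by rw [shiftWord, shiftWord, hp q hq], letterKey_shift_lt (a p) hlt⟩

theorem wordKey_insertWord_lt {n : ℕ} (p : Fin (n + 1)) (a : Fin N → ℕ) {w w' : Fin n → Letter N i}
    (h : wordKey w < wordKey w') : wordKey (insertWord p a w) < wordKey (insertWord p a w') := by
  rw [wordKey_lt_iff] at h ⊢
  obtain ⟨q, hq, hlt⟩ := h
  refine ⟨p.succAbove q, fun s hs => ?_, ?_⟩
  · rcases Fin.eq_self_or_eq_succAbove p s with rfl | ⟨s, rfl⟩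
    · simp [insertWord]
    · simpa [insertWord] using hq s ((Fin.succAbove_lt_succAbove_iff).1 hs)
  · simpa [insertWord] using hlt

theorem injective_of_wordKey_lt {n m : ℕ} (f : (Fin n → Letter N i) → (Fin m → Letter N i))
    (hf : ∀ w w', wordKey w < wordKey w' → wordKey (f w) < wordKey (f w')) :
    Function.Injective f := by
  intro w w' h
  rcases lt_trichotomy (wordKey w) (wordKey w') with h' | h' | h'
  · exact absurd (hf _ _ h') (by rw [h]; exact lt_irrefl _)
  · exact wordKey_injective h'
  · exact absurd (hf _ _ h') (by rw [h]; exact lt_irrefl _)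

variable {k : Type*} [Field k]

/-- The word `w` is the leading word of `z`. -/
def IsLeadingWord {n : ℕ} (z : (Fin n → Letter N i) →₀ k) (w : Fin n → Letter N i) : Prop :=
  w ∈ z.support ∧ ∀ w' ∈ z.support, wordKey w' ≤ wordKey w

theorem exists_isLeadingWord {n : ℕ} {z : (Fin n → Letter N i) →₀ k} (hz : z ≠ 0) :
    ∃ w, IsLeadingWord z w := by
  obtain ⟨w, hw, h⟩ := z.support.exists_max_image wordKey (Finsupp.support_nonempty_iff.2 hz)
  exact ⟨w, hw, h⟩

theorem IsLeadingWord.mapDomain {n m : ℕ} {f : (Fin n → Letter N i) → (Fin m → Letter N i)}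
    (hf : ∀ w w', wordKey w < wordKey w' → wordKey (f w) < wordKey (f w'))
    {z : (Fin n → Letter N i) →₀ k} {w : Fin n → Letter N i} (h : IsLeadingWord z w) :
    IsLeadingWord (z.mapDomain f) (f w) := by
  classical
  constructor
  · rw [Finsupp.mem_support_iff, Finsupp.mapDomain_apply (injective_of_wordKey_lt f hf)]
    exact Finsupp.mem_support_iff.1 h.1
  · intro w' hw'
    obtain ⟨w'', hw'', rfl⟩ := Finset.mem_image.1 (Finsupp.mapDomain_support hw')
    rcases (h.2 w'' hw'').lt_or_eq with h' | h'
    · exact (hf _ _ h').le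
    · rw [wordKey_injective h']

/-- A family of spaces of linear combinations of marked words that is closed under letterwise
multiplication by words of a fixed degree, and under insertion of unmarked letters. -/
structure IsWordFamily (Z : (d n : ℕ) → Submodule k ((Fin n → Letter N i) →₀ k)) : Prop where
  marked : ∀ {d n z w}, z ∈ Z d n → w ∈ z.support → IsMarkedWord d n w
  shift : ∀ {d n e z} (a : Fin n → Fin N → ℕ), (∀ p, ∑ x, a p x = e) → z ∈ Z d n →
    z.mapDomain (shiftWord a) ∈ Z (d + e) n
  insert : ∀ {d n z} (p : Fin (n + 1)) (a : Fin N → ℕ), ∑ x, a x = d → z ∈ Z d n →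
    z.mapDomain (insertWord p a) ∈ Z d (n + 1)

/-- Divisibility of letters: the markers agree and the exponents are ordered. -/
def LetterLE (l l' : Letter N i) : Prop := l.1 ≤ l'.1 ∧ l.2 = l'.2

instance : IsPreorder (Letter N i) LetterLE where
  refl _ := ⟨le_rfl, rfl⟩
  trans _ _ _ h h' := ⟨h.1.trans h'.1, h.2.trans h'.2⟩

theorem wellQuasiOrdered_letterLE : WellQuasiOrdered (LetterLE (N := N) (i := i)) :=
  WellQuasiOrdered.prod (r := fun a b : Fin N → ℕ => a ≤ b) wellQuasiOrdered_le
    (Finite.wellQuasiOrdered _)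

/-- Higman's lemma, for words together with a degree. -/
theorem wellQuasiOrdered_words :
    WellQuasiOrdered fun x y : ℕ × List (Letter N i) =>
      x.1 ≤ y.1 ∧ List.SublistForall₂ LetterLE x.2 y.2 := by
  refine WellQuasiOrdered.prod (r := fun a b : ℕ => a ≤ b) wellQuasiOrdered_le ?_
  have h := Set.PartiallyWellOrderedOn.partiallyWellOrderedOn_sublistForall₂
    (LetterLE (N := N) (i := i)) (s := Set.univ)
    (Set.partiallyWellOrderedOn_univ_iff.2 wellQuasiOrdered_letterLE)
  exact Set.partiallyWellOrderedOn_univ_iff.1 (by simpa using h)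

theorem exists_strictMono_of_sublistForall₂ {m n : ℕ} (g : Fin m → Letter N i)
    (w : Fin n → Letter N i)
    (h : List.SublistForall₂ LetterLE (List.ofFn g) (List.ofFn w)) :
    ∃ f : Fin m → Fin n, StrictMono f ∧ ∀ q, LetterLE (g q) (w (f q)) := by
  obtain ⟨l, hl, hs⟩ := List.sublistForall₂_iff.1 h
  obtain ⟨f, hf⟩ := List.sublist_iff_exists_fin_orderEmbedding_get_eq.1 hs
  obtain ⟨hlen, hget⟩ := List.forall₂_iff_get.1 hl
  have hlen' : m = l.length := by simpa using hlen
  refine ⟨fun q => Fin.cast (by simp) (f (Fin.cast hlen' q)), ?_, ?_⟩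
  · intro q q' hq
    have : Fin.cast hlen' q < Fin.cast hlen' q' := hq
    exact f.strictMono this
  · intro q
    have h1 := hget q (by simp) (hlen' ▸ q.2)
    have h2 := hf (Fin.cast hlen' q)
    simp only [List.get_eq_getElem, List.getElem_ofFn] at h1 h2
    have h3 : l[(q : ℕ)]'(hlen' ▸ q.2) = w (Fin.cast (by simp) (f (Fin.cast hlen' q))) := h2
    rw [h3] at h1
    exact h1

variable {Z : (d n : ℕ) → Submodule k ((Fin n → Letter N i) →₀ k)}

theorem removeNth_isMarkedWord {d n : ℕ} {w : Fin (n + 1) → Letter N i}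
    (hw : IsMarkedWord d (n + 1) w) (p : Fin (n + 1)) (hp : (w p).2 = none) :
    IsMarkedWord d n (p.removeNth w) := by
  refine ⟨fun q => hw.degree _, fun l => ?_⟩
  obtain ⟨q, hq, huniq⟩ := hw.marker l
  have hqp : q ≠ p := by
    rintro rfl
    rw [hp] at hq
    exact Option.some_ne_none _ hq.symm
  obtain ⟨q, rfl⟩ := Fin.exists_succAbove_eq hqp
  exact ⟨q, hq, fun q' hq' => Fin.succAbove_right_injective (huniq _ hq')⟩

/-- A marked word that is strictly longer than a marked word embedded in it contains an unmarked
letter outside the embedded word. -/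
theorem exists_unmarked {d e m n : ℕ} {g : Fin m → Letter N i} {w : Fin (n + 1) → Letter N i}
    (hg : IsMarkedWord e m g) (hw : IsMarkedWord d (n + 1) w) (hmn : m ≤ n)
    {f : Fin m → Fin (n + 1)} (hf : StrictMono f) (hgw : ∀ q, LetterLE (g q) (w (f q))) :
    ∃ p, (w p).2 = none ∧ ∃ f' : Fin m → Fin n, StrictMono f' ∧
      ∀ q, LetterLE (g q) (p.removeNth w (f' q)) := by
  obtain ⟨p, hp⟩ : ∃ p, ∀ q, f q ≠ p := by
    by_contra! h
    have := Fintype.card_le_of_surjective f h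
    simp at this
    omega
  refine ⟨p, ?_, ?_⟩
  · cases ho : (w p).2 with
    | none => rfl
    | some l =>
      obtain ⟨q, hq, -⟩ := hg.marker l
      exact absurd ((hw.marker l).unique ((hgw q).2.symm.trans hq) ho) (hp q)
  · choose f' hf' using fun q => Fin.exists_succAbove_eq (hp q)
    refine ⟨f', fun q q' hq => ?_, fun q => ?_⟩
    · rw [← Fin.succAbove_lt_succAbove_iff (p := p), hf', hf']
      exact hf hq
    · rw [Fin.removeNth, hf']
      exact hgw q

/-- The leading words of a word family are closed under divisibility of words. -/
theorem IsWordFamily.exists_isLeadingWord (hZ : IsWordFamily Z) {d e m : ℕ}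
    {z : (Fin m → Letter N i) →₀ k} {g : Fin m → Letter N i} (hz : z ∈ Z e m)
    (hg : IsLeadingWord z g) (hed : e ≤ d) : ∀ {n : ℕ} {w : Fin n → Letter N i},
    IsMarkedWord d n w → ∀ f : Fin m → Fin n, StrictMono f →
    (∀ q, LetterLE (g q) (w (f q))) → ∃ z' ∈ Z d n, IsLeadingWord z' w := by
  have hgm : IsMarkedWord e m g := hZ.marked hz hg.1
  intro n
  induction n with
  | zero =>
    intro w hw f hf hgw
    have hm : m = 0 := Nat.eq_zero_of_not_pos fun hm => (f ⟨0, hm⟩).elim0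
    subst hm
    obtain ⟨c, rfl⟩ := Nat.exists_eq_add_of_le hed
    refine ⟨z.mapDomain (shiftWord fun p => p.elim0), hZ.shift _ (fun p => p.elim0) hz, ?_⟩
    have := hg.mapDomain (fun _ _ => wordKey_shiftWord_lt (fun p : Fin 0 => p.elim0))
    rwa [Subsingleton.elim (shiftWord _ g) w] at this
  | succ n ih =>
    intro w hw f hf hgw
    have hmn : m ≤ n + 1 := by simpa using Fintype.card_le_of_injective f hf.injective
    rcases hmn.lt_or_eq with hlt | rfl
    · obtain ⟨p, hp, f', hf', hgw'⟩ := exists_unmarked hgm hw (Nat.lt_succ_iff.1 hlt) hf hgw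
      obtain ⟨z', hz', hl⟩ := ih (removeNth_isMarkedWord hw p hp) f' hf' hgw'
      refine ⟨z'.mapDomain (insertWord p (w p).1), hZ.insert p _ (hw.degree p) hz', ?_⟩
      have := hl.mapDomain (fun _ _ => wordKey_insertWord_lt p (w p).1)
      have hw' : insertWord p (w p).1 (p.removeNth w) = w := by
        rw [insertWord, ← hp]
        exact Fin.insertNth_self_removeNth p w
      rwa [hw'] at this
    · have hid : f = id := by
        refine (StrictMono.range_inj hf strictMono_id).1 ?_
        rw [Set.range_id, (Finite.injective_iff_surjective.1 hf.injective).range_eq]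
      subst hid
      obtain ⟨c, rfl⟩ := Nat.exists_eq_add_of_le hed
      have hle : ∀ p x, (g p).1 x ≤ (w p).1 x := fun p => (hgw p).1
      refine ⟨z.mapDomain (shiftWord fun p => (w p).1 - (g p).1), hZ.shift _ (fun p => ?_) hz, ?_⟩
      · have h1 := hw.degree p
        have h2 := hgm.degree p
        have h3 : ∑ x, ((w p).1 - (g p).1) x + ∑ x, (g p).1 x = ∑ x, (w p).1 x := by
          rw [← Finset.sum_add_distrib]
          exact Finset.sum_congr rfl fun x _ => Nat.sub_add_cancel (hle p x)
        omega
      · have := hg.mapDomain (fun _ _ => wordKey_shiftWord_lt fun p => (w p).1 - (g p).1)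
        have hw' : shiftWord (fun p => (w p).1 - (g p).1) g = w := by
          funext p
          refine Prod.ext ?_ (hgw p).2
          funext x
          exact Nat.add_sub_cancel' (hle p x)
        rwa [hw'] at this

/-- Every leading word of a family is divisible by a leading word of bounded length. -/
theorem exists_bound_isLeadingWord
    (Z : (d n : ℕ) → Submodule k ((Fin n → Letter N i) →₀ k)) :
    ∃ C, ∀ d n, C ≤ n → ∀ z ∈ Z d (n + 1), ∀ w, IsLeadingWord z w →
      ∃ e m, ∃ z' ∈ Z e m, ∃ g, IsLeadingWord z' g ∧ e ≤ d ∧ m ≤ n ∧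
        ∃ f : Fin m → Fin (n + 1), StrictMono f ∧ ∀ q, LetterLE (g q) (w (f q)) := by
  by_contra! hcon
  let P : ℕ × List (Letter N i) → Prop := fun x =>
    ∃ n, ∃ z ∈ Z x.1 n, ∃ w, IsLeadingWord z w ∧ x.2 = List.ofFn w
  -- otherwise there is a sequence of leading words none of which divides a later one
  obtain ⟨f, hf, hbad⟩ := exists_seq_of_forall_finset_exists P
    (fun x y => ¬ (x.1 ≤ y.1 ∧ List.SublistForall₂ LetterLE x.2 y.2)) fun s hs => by
      obtain ⟨d, n, hn, z, hz, w, hw, h⟩ := hcon (s.sup fun x => x.2.length)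
      refine ⟨(d, List.ofFn w), ⟨n + 1, z, hz, w, hw, rfl⟩, fun x hx hxy => ?_⟩
      obtain ⟨m, z', hz', g, hg, hxg⟩ := hs x hx
      have hm : m ≤ n := by
        have := (Finset.le_sup (f := fun x : ℕ × List (Letter N i) => x.2.length) hx).trans hn
        simpa [hxg] using this
      rw [hxg] at hxy
      obtain ⟨f, hf, hfq⟩ := exists_strictMono_of_sublistForall₂ g w hxy.2
      obtain ⟨q, hq⟩ := h x.1 m z' hz' g hg hxy.1 hm f hf
      exact hq (hfq q)
  obtain ⟨a, c, hac, h⟩ := wellQuasiOrdered_words f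
  exact hbad a c hac h

/-- Noetherianity of word families: the elements of large length are obtained by insertions from
elements of smaller length, uniformly in the degree of the letters. -/
theorem IsWordFamily.exists_le_span (hZ : IsWordFamily Z) :
    ∃ C, ∀ d n, C ≤ n → Z d (n + 1) ≤ Submodule.span k
      {x | ∃ p a, ∃ z ∈ Z d n, ∑ y, a y = d ∧ x = Finsupp.mapDomain (insertWord p a) z} := by
  obtain ⟨C, hC⟩ := exists_bound_isLeadingWord Z
  refine ⟨C, fun d n hn => ?_⟩
  have key : ∀ t : Lex (Fin (n + 1) → Lex (Fin N → ℕ) ×ₗ WithBot (Fin i)), ∀ z ∈ Z d (n + 1),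
      ∀ w, IsLeadingWord z w → wordKey w = t → z ∈ Submodule.span k
        {x | ∃ p a, ∃ z ∈ Z d n, ∑ y, a y = d ∧ x = Finsupp.mapDomain (insertWord p a) z} := by
    intro t
    induction t using WellFoundedLT.induction with
    | ind t ih =>
    intro z hz w hw ht
    obtain ⟨e, m, z', hz', g, hg, hed, hmn, f, hf, hgw⟩ := hC d n hn z hz w hw
    have hwm := hZ.marked hz hw.1
    obtain ⟨p, hp, f', hf', hgw'⟩ := exists_unmarked (hZ.marked hz' hg.1) hwm hmn hf hgw
    obtain ⟨y, hy, hyl⟩ := hZ.exists_isLeadingWord hz' hg hed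
      (removeNth_isMarkedWord hwm p hp) f' hf' hgw'
    set x := Finsupp.mapDomain (insertWord p (w p).1) y with hx
    have hxl : IsLeadingWord x w := by
      have := hyl.mapDomain (fun _ _ => wordKey_insertWord_lt p (w p).1)
      have hw' : insertWord p (w p).1 (p.removeNth w) = w := by
        rw [insertWord, ← hp]
        exact Fin.insertNth_self_removeNth p w
      rwa [hw'] at this
    have hxZ : x ∈ Z d (n + 1) := hZ.insert p _ (hwm.degree p) hy
    have hxS : x ∈ Submodule.span k
        {x | ∃ p a, ∃ z ∈ Z d n, ∑ y, a y = d ∧ x = Finsupp.mapDomain (insertWord p a) z} :=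
      Submodule.subset_span ⟨p, (w p).1, y, hy, hwm.degree p, hx⟩
    have hxw : x w ≠ 0 := Finsupp.mem_support_iff.1 hxl.1
    -- cancel the leading words
    set z₁ := z - (z w / x w) • x with hz₁
    have hz₁Z : z₁ ∈ Z d (n + 1) := sub_mem hz (Submodule.smul_mem _ _ hxZ)
    have hz₁S : z₁ ∈ Submodule.span k
        {x | ∃ p a, ∃ z ∈ Z d n, ∑ y, a y = d ∧ x = Finsupp.mapDomain (insertWord p a) z} := by
      by_cases h0 : z₁ = 0
      · rw [h0]; exact zero_mem _
      obtain ⟨w₁, hw₁⟩ := SecantSyzygies.exists_isLeadingWord h0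
      refine ih (wordKey w₁) ?_ z₁ hz₁Z w₁ hw₁ rfl
      have hne : w₁ ≠ w := by
        rintro rfl
        have := Finsupp.mem_support_iff.1 hw₁.1
        apply this
        rw [hz₁, Finsupp.sub_apply, Finsupp.smul_apply, smul_eq_mul, div_mul_cancel₀ _ hxw,
          sub_self]
      have hle : wordKey w₁ ≤ wordKey w := by
        by_cases h1 : w₁ ∈ z.support
        · exact hw.2 _ h1
        · refine hxl.2 _ (Finsupp.mem_support_iff.2 fun h2 => ?_)
          apply Finsupp.mem_support_iff.1 hw₁.1
          rw [hz₁, Finsupp.sub_apply, Finsupp.smul_apply, h2, Finsupp.notMem_support_iff.1 h1,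
            smul_zero, sub_zero]
      rw [← ht]
      exact lt_of_le_of_ne hle fun h => hne (wordKey_injective h)
    have : z = z₁ + (z w / x w) • x := by rw [hz₁]; abel
    rw [this]
    exact add_mem hz₁S (Submodule.smul_mem _ _ hxS)
  intro z hz
  by_cases h0 : z = 0
  · rw [h0]; exact zero_mem _
  obtain ⟨w, hw⟩ := SecantSyzygies.exists_isLeadingWord h0
  exact key _ z hz w hw rfl

end Words

/-! ### Secant ideals as kernels -/

section SecantKernel

variable {k : Type*} [Field k] {B : Type*} [CommRing B] [Algebra k B]
  {Q : Type*} [CommRing Q] [Algebra k Q]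

/-- Given algebra homomorphisms `β j : B → Q`, the map `w ↦ ∑ j, β j w · X j` on a subspace
of `B`. -/
noncomputable def colorSum {r : ℕ} (β : Fin r → B →ₐ[k] Q) (W : Submodule k B) :
    W →ₗ[k] MvPolynomial (Fin r) Q :=
  ∑ j, LinearMap.mulLeft k (MvPolynomial.X j) ∘ₗ
    (Algebra.linearMap Q (MvPolynomial (Fin r) Q)).restrictScalars k ∘ₗ
      (β j).toLinearMap ∘ₗ W.subtype

theorem colorSum_apply {r : ℕ} (β : Fin r → B →ₐ[k] Q) (W : Submodule k B) (w : W) :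
    colorSum β W w = ∑ j, MvPolynomial.X j * MvPolynomial.C (β j w) := by
  simp [colorSum, LinearMap.sum_apply, MvPolynomial.algebraMap_eq]

/-- The algebra homomorphism `Sym(W) → Q[X]` that extends `colorSum`. If `Q` is the tensor power
`B^{⊗ r}` with its `r` canonical maps from `B`, then its image is the subring of `B[X]^{⊗ r}`
generated by the sums of the conjugates of the elements `w X`, that is, the coordinate ring of the
`r`th secant variety. -/
noncomputable def colorHom {r : ℕ} (β : Fin r → B →ₐ[k] Q) (W : Submodule k B) :
    SymmetricAlgebra k W →ₐ[k] MvPolynomial (Fin r) Q :=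
  SymmetricAlgebra.lift (colorSum β W)

theorem colorHom_ι {r : ℕ} (β : Fin r → B →ₐ[k] Q) (W : Submodule k B) (w : W) :
    colorHom β W (SymmetricAlgebra.ι k W w) = ∑ j, MvPolynomial.X j * MvPolynomial.C (β j w) := by
  rw [colorHom, SymmetricAlgebra.lift_ι_apply, colorSum_apply]

theorem colorHom_isHomogeneous {r : ℕ} (β : Fin r → B →ₐ[k] Q) (W : Submodule k B) (m : ℕ)
    (s : SymmetricAlgebra k W) (hs : s ∈ symPow k W m) : (colorHom β W s).IsHomogeneous m := by
  unfold symPow at hs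
  induction hs using Submodule.pow_induction_on_left' with
  | algebraMap a =>
    rw [AlgHom.commutes, IsScalarTower.algebraMap_apply k Q, MvPolynomial.algebraMap_eq]
    exact MvPolynomial.isHomogeneous_C _ _
  | add x y i hx hy ihx ihy => rw [map_add]; exact ihx.add ihy
  | mem_mul m hm i x hx ih =>
    obtain ⟨w, rfl⟩ := hm
    rw [map_mul, colorHom_ι, Nat.succ_eq_add_one, add_comm i 1]
    refine MvPolynomial.IsHomogeneous.mul (MvPolynomial.IsHomogeneous.sum _ _ _ fun j _ => ?_) ih
    have := (MvPolynomial.isHomogeneous_X Q j).mul (MvPolynomial.isHomogeneous_C (Fin r) (β j w))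
    rwa [add_zero] at this

theorem colorHom_symProj {r : ℕ} (β : Fin r → B →ₐ[k] Q) (W : Submodule k B) (m : ℕ)
    (s : SymmetricAlgebra k W) :
    colorHom β W (symProj k W m s) = MvPolynomial.homogeneousComponent m (colorHom β W s) := by
  induction s using DirectSum.Decomposition.inductionOn (symPow k W) with
  | zero => simp
  | @homogeneous e s =>
    rw [MvPolynomial.homogeneousComponent_of_mem (colorHom_isHomogeneous β W e _ s.2),
      symProj_apply]
    by_cases h : m = e
    · subst h
      rw [DirectSum.decompose_of_mem_same _ s.2, if_pos rfl]
    · rw [DirectSum.decompose_of_mem_ne _ s.2 (Ne.symm h), map_zero, if_neg h]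
  | add s t hs ht => simp only [map_add, Submodule.coe_add, hs, ht]

theorem tmul_map_mkQ_eq_zero_iff {X Y X' Y' : Type*} [AddCommGroup X] [Module k X] [AddCommGroup Y]
    [Module k Y] [AddCommGroup X'] [Module k X'] [AddCommGroup Y'] [Module k Y']
    (f : X →ₗ[k] X') (g : Y →ₗ[k] Y') (P : Submodule k X) (R : Submodule k Y)
    (hP : P = LinearMap.ker f) (hR : R = LinearMap.ker g) (t : X ⊗[k] Y) :
    TensorProduct.map P.mkQ R.mkQ t = 0 ↔ TensorProduct.map f g t = 0 := by
  subst hP hR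
  have hf : Function.Injective ((LinearMap.ker f).liftQ f le_rfl) :=
    LinearMap.ker_eq_bot.1 (Submodule.ker_liftQ_eq_bot' _ _ rfl)
  have hg : Function.Injective ((LinearMap.ker g).liftQ g le_rfl) :=
    LinearMap.ker_eq_bot.1 (Submodule.ker_liftQ_eq_bot' _ _ rfl)
  have h := TensorProduct.map_injective_of_flat_flat _ _ hf hg
  rw [← map_eq_zero_iff _ h, ← LinearMap.comp_apply, ← TensorProduct.map_comp,
    Submodule.liftQ_mkQ, Submodule.liftQ_mkQ]

theorem coe_mulι {W : Type*} [AddCommGroup W] [Module k W] (w : W) (m : ℕ) (y : symPow k W m) :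
    (mulι k W w m y : SymmetricAlgebra k W) = SymmetricAlgebra.ι k W w * y := rfl

variable (B) in
/-- The maps `B → B ⊗ Q` attached to maps `B → Q`. -/
noncomputable def consColor {r : ℕ} (β : Fin r → B →ₐ[k] Q) : Fin (r + 1) → B →ₐ[k] B ⊗[k] Q :=
  Fin.cons Algebra.TensorProduct.includeLeft
    fun j => Algebra.TensorProduct.includeRight.comp (β j)

section Step

variable {r : ℕ} (β : Fin r → B →ₐ[k] Q) (W : Submodule k B)

/-- The component `Sym(W) → B ⊗ Q[X]` of `colorHom (consColor B β) W` in bidegree `(i, j)`, read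
off the comultiplication. -/
noncomputable def comulColor (i j : ℕ) :
    SymmetricAlgebra k W →ₗ[k] MvPolynomial (Fin r) (B ⊗[k] Q) :=
  (MvPolynomial.rTensorAlgEquiv (R := k) (S := B) (N := Q) (σ := Fin r)).toLinearMap.restrictScalars
      k ∘ₗ
    TensorProduct.map ((SymmetricAlgebra.lift W.subtype).toLinearMap ∘ₗ (symPow k W i).subtype)
      ((colorHom β W).toLinearMap ∘ₗ (symPow k W j).subtype) ∘ₗ comulPart k W i j

theorem comulColor_eq_zero_iff (i j : ℕ) (R : Submodule k (symPow k W j))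
    (hR : R = LinearMap.ker ((colorHom β W).toLinearMap ∘ₗ (symPow k W j).subtype))
    (s : SymmetricAlgebra k W) :
    TensorProduct.map (veronesePart W i).mkQ R.mkQ (comulPart k W i j s) = 0 ↔
      comulColor β W i j s = 0 := by
  refine (tmul_map_mkQ_eq_zero_iff
    ((SymmetricAlgebra.lift W.subtype).toLinearMap ∘ₗ (symPow k W i).subtype) _ _ _ rfl hR _).trans
      ?_
  exact (map_eq_zero_iff (MvPolynomial.rTensorAlgEquiv (R := k) (S := B) (N := Q) (σ := Fin r))
    (AlgEquiv.injective _)).symm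

theorem rTensorAlgEquiv_mul_left (i j : ℕ) (w : W) (t : symPow k W i ⊗[k] symPow k W j) :
    MvPolynomial.rTensorAlgEquiv (TensorProduct.map
      ((SymmetricAlgebra.lift W.subtype).toLinearMap ∘ₗ (symPow k W (i + 1)).subtype)
      ((colorHom β W).toLinearMap ∘ₗ (symPow k W j).subtype)
      (TensorProduct.map (mulι k W w i) LinearMap.id t)) =
    MvPolynomial.rTensorAlgEquiv ((w : B) ⊗ₜ[k] (1 : MvPolynomial (Fin r) Q)) *
      MvPolynomial.rTensorAlgEquiv (TensorProduct.map
        ((SymmetricAlgebra.lift W.subtype).toLinearMap ∘ₗ (symPow k W i).subtype)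
        ((colorHom β W).toLinearMap ∘ₗ (symPow k W j).subtype) t) := by
  rw [← map_mul]
  congr 1
  induction t using TensorProduct.induction_on with
  | zero => simp
  | tmul a c => simp [coe_mulι]
  | add a c ha hc => simp only [map_add, mul_add, ha, hc]

theorem rTensorAlgEquiv_mul_right (i j : ℕ) (w : W) (t : symPow k W i ⊗[k] symPow k W j) :
    MvPolynomial.rTensorAlgEquiv (TensorProduct.map
      ((SymmetricAlgebra.lift W.subtype).toLinearMap ∘ₗ (symPow k W i).subtype)
      ((colorHom β W).toLinearMap ∘ₗ (symPow k W (j + 1)).subtype)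
      (TensorProduct.map LinearMap.id (mulι k W w j) t)) =
    MvPolynomial.rTensorAlgEquiv ((1 : B) ⊗ₜ[k] colorHom β W (SymmetricAlgebra.ι k W w)) *
      MvPolynomial.rTensorAlgEquiv (TensorProduct.map
        ((SymmetricAlgebra.lift W.subtype).toLinearMap ∘ₗ (symPow k W i).subtype)
        ((colorHom β W).toLinearMap ∘ₗ (symPow k W j).subtype) t) := by
  rw [← map_mul]
  congr 1
  induction t using TensorProduct.induction_on with
  | zero => simp
  | tmul a c => simp [coe_mulι]
  | add a c ha hc => simp only [map_add, mul_add, ha, hc]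

theorem finSuccEquiv_colorHom_ι (w : W) :
    MvPolynomial.finSuccEquiv (B ⊗[k] Q) r
      (colorHom (consColor B β) W (SymmetricAlgebra.ι k W w)) =
    Polynomial.X * Polynomial.C
        (MvPolynomial.rTensorAlgEquiv ((w : B) ⊗ₜ[k] (1 : MvPolynomial (Fin r) Q))) +
      Polynomial.C
        (MvPolynomial.rTensorAlgEquiv ((1 : B) ⊗ₜ[k] colorHom β W (SymmetricAlgebra.ι k W w))) := by
  classical
  have h1 : ∀ b : B, MvPolynomial.rTensorAlgEquiv (b ⊗ₜ[k] (1 : MvPolynomial (Fin r) Q)) =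
      MvPolynomial.C (b ⊗ₜ[k] (1 : Q)) := by
    intro b
    ext d
    rw [MvPolynomial.coeff_rTensorAlgEquiv_tmul, MvPolynomial.coeff_C, MvPolynomial.coeff_one]
    split <;> simp
  have h2 : ∀ (j : Fin r) (q : Q), MvPolynomial.rTensorAlgEquiv
      ((1 : B) ⊗ₜ[k] (MvPolynomial.X j * MvPolynomial.C q)) =
      MvPolynomial.X j * MvPolynomial.C ((1 : B) ⊗ₜ[k] q) := by
    intro j q
    ext d
    rw [MvPolynomial.coeff_rTensorAlgEquiv_tmul, mul_comm, MvPolynomial.coeff_C_mul, mul_comm,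
      mul_comm (MvPolynomial.X j), MvPolynomial.coeff_C_mul, MvPolynomial.coeff_X,
      MvPolynomial.coeff_X]
    split <;> simp
  rw [colorHom_ι, colorHom_ι, Fin.sum_univ_succ, map_add, h1, TensorProduct.tmul_sum, map_sum,
    map_sum, map_sum]
  congr 1
  · simp [consColor, MvPolynomial.finSuccEquiv_apply]
  · refine Finset.sum_congr rfl fun j _ => ?_
    rw [h2]
    simp [consColor, MvPolynomial.finSuccEquiv_apply]

theorem comulColor_ι_mul (w : W) (s : SymmetricAlgebra k W) (i j : ℕ) :
    comulColor β W i j (SymmetricAlgebra.ι k W w * s) =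
      MvPolynomial.rTensorAlgEquiv ((w : B) ⊗ₜ[k] (1 : MvPolynomial (Fin r) Q)) *
          (if i = 0 then 0 else comulColor β W (i - 1) j s) +
        MvPolynomial.rTensorAlgEquiv ((1 : B) ⊗ₜ[k] colorHom β W (SymmetricAlgebra.ι k W w)) *
          (if j = 0 then 0 else comulColor β W i (j - 1) s) := by
  change MvPolynomial.rTensorAlgEquiv (TensorProduct.map _ _ (comulPart k W i j _)) = _
  rw [comulPart_eq, comul_ι_mul, map_add, map_add, map_add]
  congr 1
  · cases i with
    | zero => rw [map_symProj_left_mul_zero]; simp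
    | succ i =>
      rw [map_symProj_left_mul, rTensorAlgEquiv_mul_left, if_neg (Nat.succ_ne_zero i)]
      rfl
  · cases j with
    | zero => rw [map_symProj_right_mul_zero]; simp
    | succ j =>
      rw [map_symProj_right_mul, rTensorAlgEquiv_mul_right, if_neg (Nat.succ_ne_zero j)]
      rfl

theorem coe_symProj_algebraMap {W : Type*} [AddCommGroup W] [Module k W] (a : k) (i : ℕ) :
    (symProj k W i (algebraMap k _ a) : SymmetricAlgebra k W) =
      if i = 0 then algebraMap k _ a else 0 := by
  have ha := SetLike.algebraMap_mem_graded (symPow k W) a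
  rw [symProj_apply]
  split
  · next h => subst h; exact DirectSum.decompose_of_mem_same _ ha
  · next h => exact DirectSum.decompose_of_mem_ne _ ha (Ne.symm h)

theorem comulColor_algebraMap (a : k) (i j : ℕ) :
    comulColor β W i j (algebraMap k _ a) =
      if i = 0 ∧ j = 0 then algebraMap k (MvPolynomial (Fin r) (B ⊗[k] Q)) a else 0 := by
  have h1 : comulPart k W i j (algebraMap k _ a) =
      symProj k W i (algebraMap k _ a) ⊗ₜ[k] symProj k W j 1 := by
    rw [comulPart_eq, Bialgebra.comul_algebraMap, Algebra.TensorProduct.algebraMap_apply,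
      TensorProduct.map_tmul]
  have h2 : comulColor β W i j (algebraMap k _ a) = MvPolynomial.rTensorAlgEquiv
      (SymmetricAlgebra.lift W.subtype (symProj k W i (algebraMap k _ a)) ⊗ₜ[k]
        colorHom β W (symProj k W j 1)) := by
    rw [comulColor, LinearMap.comp_apply, LinearMap.comp_apply, h1, TensorProduct.map_tmul]
    rfl
  have h3 : (symProj k W j 1 : SymmetricAlgebra k W) = if j = 0 then 1 else 0 := by
    simpa using coe_symProj_algebraMap (W := W) (1 : k) j
  rw [h2, h3, coe_symProj_algebraMap]
  by_cases hi : i = 0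
  · by_cases hj : j = 0
    · rw [if_pos hi, if_pos hj, if_pos ⟨hi, hj⟩, AlgHom.commutes, map_one]
      exact (AlgEquiv.commutes _ (algebraMap k B a)).trans
        (IsScalarTower.algebraMap_apply k B _ a).symm
    · simp [hj]
  · simp [hi]

/-- The comultiplication splits `colorHom (consColor B β) W` by the degree in the first variable. -/
theorem comulColor_eq_coeff (m : ℕ) (s : SymmetricAlgebra k W) (hs : s ∈ symPow k W m) :
    (∀ i j, comulColor β W i j s = if i + j = m then
      (MvPolynomial.finSuccEquiv (B ⊗[k] Q) r (colorHom (consColor B β) W s)).coeff i else 0) ∧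
    ∀ i, m < i →
      (MvPolynomial.finSuccEquiv (B ⊗[k] Q) r (colorHom (consColor B β) W s)).coeff i = 0 := by
  unfold symPow at hs
  induction hs using Submodule.pow_induction_on_left' with
  | algebraMap a =>
    have hcoeff : MvPolynomial.finSuccEquiv (B ⊗[k] Q) r
        (colorHom (consColor B β) W (algebraMap k _ a)) =
        Polynomial.C (algebraMap k (MvPolynomial (Fin r) (B ⊗[k] Q)) a) := by
      rw [AlgHom.commutes, IsScalarTower.algebraMap_apply k (B ⊗[k] Q), AlgEquiv.commutes,
        IsScalarTower.algebraMap_apply (B ⊗[k] Q) (MvPolynomial (Fin r) (B ⊗[k] Q)),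
        ← IsScalarTower.algebraMap_apply k]
      rfl
    rw [hcoeff]
    refine ⟨fun i j => ?_, fun i hi => ?_⟩
    · rw [comulColor_algebraMap]
      rcases i with _ | i <;> rcases j with _ | j <;> simp
    · rw [Polynomial.coeff_C, if_neg (by omega)]
  | add x y i hx hy ihx ihy =>
    refine ⟨fun i' j => ?_, fun i' hi => ?_⟩
    · rw [map_add, ihx.1, ihy.1, map_add, map_add, Polynomial.coeff_add]
      split <;> simp
    · rw [map_add, map_add, Polynomial.coeff_add, ihx.2 _ hi, ihy.2 _ hi, add_zero]
  | mem_mul m hm n x hx ih =>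
    obtain ⟨w, rfl⟩ := hm
    have hc : ∀ i, (MvPolynomial.finSuccEquiv (B ⊗[k] Q) r (colorHom (consColor B β) W
        (SymmetricAlgebra.ι k W w * x))).coeff i =
        MvPolynomial.rTensorAlgEquiv ((w : B) ⊗ₜ[k] (1 : MvPolynomial (Fin r) Q)) *
          (if i = 0 then 0 else (MvPolynomial.finSuccEquiv (B ⊗[k] Q) r
            (colorHom (consColor B β) W x)).coeff (i - 1)) +
        MvPolynomial.rTensorAlgEquiv ((1 : B) ⊗ₜ[k] colorHom β W (SymmetricAlgebra.ι k W w)) *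
          (MvPolynomial.finSuccEquiv (B ⊗[k] Q) r (colorHom (consColor B β) W x)).coeff i := by
      intro i
      rw [map_mul, map_mul, finSuccEquiv_colorHom_ι, add_mul, Polynomial.coeff_add,
        Polynomial.coeff_C_mul, mul_assoc]
      congr 1
      cases i with
      | zero => simp
      | succ i => simp
    refine ⟨fun i j => ?_, fun i hi => ?_⟩
    · rw [comulColor_ι_mul, hc, ih.1, ih.1]
      rcases i with _ | i <;> rcases j with _ | j
      · simp
      · simp
      · by_cases h : i = n
        · subst h
          simp [ih.2 (i + 1) (by omega)]
        · simp [h]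
      · by_cases h : i + 1 + j = n
        · subst h
          simp [show i + (j + 1) = i + 1 + j by omega,
            show i + 1 + (j + 1) = i + 1 + j + 1 by omega]
        · simp [h, show ¬ (i + (j + 1) = n) by omega, show ¬ (i + 1 + (j + 1) = n + 1) by omega]
    · rw [hc, ih.2 i (by omega), if_neg (by omega), ih.2 (i - 1) (by omega)]
      simp

end Step

/-- The secant ideals of all subspaces of `B` are the kernels of the maps `colorHom`, for the same
algebra `Q` (a tensor power of `B`). -/
theorem exists_secantPart_iff {k : Type u} [Field k] (B : Type v) [CommRing B] [Algebra k B]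
    (r : ℕ) :
    ∃ (Q : Type v) (_ : CommRing Q) (_ : Algebra k Q) (β : Fin (r + 1) → B →ₐ[k] Q),
      ∀ (W : Submodule k B) (m : ℕ) (y : symPow k W m),
        y ∈ secantPart W (r + 1) m ↔ colorHom β W y = 0 := by
  induction r with
  | zero =>
    -- on `Sym^m(W)` the map is the multiplication map times the `m`th power of the variable
    refine ⟨B, inferInstance, inferInstance, fun _ => AlgHom.id k B, fun W m y => ?_⟩
    have h : ∀ (s : SymmetricAlgebra k W), s ∈ symPow k W m →
        colorHom (fun _ : Fin 1 => AlgHom.id k B) W s =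
          MvPolynomial.X 0 ^ m * MvPolynomial.C (SymmetricAlgebra.lift W.subtype s) := by
      intro s hs
      clear y
      unfold symPow at hs
      induction hs using Submodule.pow_induction_on_left' with
      | algebraMap a => simp
      | add x y i hx hy ihx ihy => simp only [map_add, ihx, ihy, mul_add]
      | mem_mul m hm i x hx ih =>
        obtain ⟨w, rfl⟩ := hm
        rw [map_mul, ih, colorHom_ι]
        simp [pow_succ]
        ring
    change SymmetricAlgebra.lift W.subtype (y : SymmetricAlgebra k W) = 0 ↔ _
    rw [h _ y.2, mul_comm, MvPolynomial.X_pow_eq_monomial, MvPolynomial.C_mul_monomial, mul_one,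
      MvPolynomial.monomial_eq_zero]
  | succ r ih =>
    obtain ⟨Q, _, _, β, hβ⟩ := ih
    refine ⟨B ⊗[k] Q, inferInstance, inferInstance, consColor B β, fun W m y => ?_⟩
    rw [mem_secantPart_succ_succ]
    have hker : ∀ j, secantPart W (r + 1) j =
        LinearMap.ker ((colorHom β W).toLinearMap ∘ₗ (symPow k W j).subtype) :=
      fun j => Submodule.ext fun y => hβ W j y
    simp only [comulColor_eq_zero_iff β W _ _ _ (hker _)]
    obtain ⟨h1, h2⟩ := comulColor_eq_coeff β W m y y.2
    rw [← map_eq_zero_iff _ (MvPolynomial.finSuccEquiv (B ⊗[k] Q) (r + 1)).injective]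
    constructor
    · intro h
      refine Polynomial.ext fun i => ?_
      rw [Polynomial.coeff_zero]
      rcases le_or_gt i m with hi | hi
      · have := h i (m - i) (by omega)
        rwa [h1, if_pos (by omega)] at this
      · exact h2 i hi
    · intro h i j hij
      rw [h1, if_pos hij, h, Polynomial.coeff_zero]

theorem exists_mem_secantIdeal_iff {k : Type u} [Field k] (B : Type v) [CommRing B] [Algebra k B]
    {r : ℕ} (hr : 1 ≤ r) :
    ∃ (Q : Type v) (_ : CommRing Q) (_ : Algebra k Q) (β : Fin r → B →ₐ[k] Q),
      ∀ (W : Submodule k B) (s : SymmetricAlgebra k W),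
        s ∈ secantIdeal W r ↔ colorHom β W s = 0 := by
  obtain ⟨r, rfl⟩ := Nat.exists_eq_add_of_le' hr
  obtain ⟨Q, _, _, β, hβ⟩ := exists_secantPart_iff (k := k) B r
  refine ⟨Q, inferInstance, inferInstance, β, fun W s => ?_⟩
  change (∀ m, symProj k W m s ∈ secantPart W (r + 1) m) ↔ _
  simp only [hβ, colorHom_symProj]
  constructor
  · intro h
    rw [← MvPolynomial.sum_homogeneousComponent (colorHom β W s)]
    exact Finset.sum_eq_zero fun m _ => h m
  · intro h m
    rw [h, map_zero]

end SecantKernel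

/-! ### Words as elements of the Koszul complex -/

section Evaluation

variable {k : Type*} [Field k] {B : Type*} [CommRing B] [Algebra k B] {N : ℕ} (x : Fin N → B)

/-- The monomial with exponent `a` in the elements `x`. -/
def mon (a : Fin N → ℕ) : B := ∏ t, x t ^ a t

theorem mon_add (a c : Fin N → ℕ) : mon x (a + c) = mon x a * mon x c := by
  simp [mon, pow_add, Finset.prod_mul_distrib]

variable (k) in
/-- The span of the monomials of degree `d`. -/
def monPart (d : ℕ) : Submodule k B := Submodule.span k (mon x '' {a | ∑ t, a t = d})

variable (k) in
open Classical in
/-- The monomial with exponent `a` as an element of the span of the monomials of degree `d`, with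
the value zero if the degree of `a` is not `d`. -/
noncomputable def monElem (d : ℕ) (a : Fin N → ℕ) : monPart k x d :=
  if h : ∑ t, a t = d then ⟨mon x a, Submodule.subset_span ⟨a, h, rfl⟩⟩ else 0

theorem coe_monElem {d : ℕ} {a : Fin N → ℕ} (h : ∑ t, a t = d) :
    (monElem k x d a : B) = mon x a := by
  rw [monElem, dif_pos h]

theorem linearCombination_const_mul {α A : Type*} [CommRing A] [Algebra k A] (c : A) (g : α → A)
    (z : α →₀ k) : Finsupp.linearCombination k (fun w => c * g w) z =
      c * Finsupp.linearCombination k g z := by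
  rw [Finsupp.linearCombination_apply, Finsupp.linearCombination_apply, Finsupp.mul_sum]
  exact Finsupp.sum_congr fun w _ => (mul_smul_comm _ _ _).symm

theorem linearCombination_congr {α A : Type*} [AddCommGroup A] [Module k A] {g g' : α → A}
    {z : α →₀ k} (h : ∀ w ∈ z.support, g w = g' w) :
    Finsupp.linearCombination k g z = Finsupp.linearCombination k g' z := by
  rw [Finsupp.linearCombination_apply, Finsupp.linearCombination_apply]
  exact Finsupp.sum_congr fun w hw => by rw [h w hw]

theorem mapDomain_neg {α α' : Type*} (f : α → α') (z : α →₀ k) :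
    Finsupp.mapDomain f (-z) = - Finsupp.mapDomain f z :=
  map_neg (Finsupp.mapDomain.addMonoidHom f) z

theorem map_linearCombination {α A A' : Type*} [AddCommGroup A] [Module k A] [AddCommGroup A']
    [Module k A'] (φ : A →ₗ[k] A') (g : α → A) (z : α →₀ k) :
    φ (Finsupp.linearCombination k g z) = Finsupp.linearCombination k (fun w => φ (g w)) z := by
  rw [Finsupp.linearCombination_apply, Finsupp.linearCombination_apply, map_finsuppSum]
  simp

variable {i r d n : ℕ}

/-- The value of a letter in `Sym(B_d)`: an unmarked letter is sent to its monomial, and a letter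
with marker `t` to the value of the functional `v t` on its monomial. -/
noncomputable def letterVal (v : Fin i → Module.Dual k (monPart k x d)) (l : Letter N i) :
    SymmetricAlgebra k (monPart k x d) :=
  match l.2 with
  | none => SymmetricAlgebra.ι k _ (monElem k x d l.1)
  | some t => algebraMap k _ (v t (monElem k x d l.1))

/-- The map from words to `⋀ⁱ B_d ⊗ Sym(B_d)`, regarded as multilinear functions of `i` functionals
on `B_d` with values in `Sym(B_d)`. -/
noncomputable def wordVal (v : Fin i → Module.Dual k (monPart k x d)) :
    ((Fin n → Letter N i) →₀ k) →ₗ[k] SymmetricAlgebra k (monPart k x d) :=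
  Finsupp.linearCombination k fun w => ∏ p, letterVal x v (w p)

theorem prod_letterVal_update (v : Fin i → Module.Dual k (monPart k x d)) (t : Fin i)
    (f : Module.Dual k (monPart k x d)) {w : Fin n → Letter N i} (hw : IsMarkedWord d n w)
    [DecidableEq (Fin i)] {p : Fin n} (hp : (w p).2 = some t) :
    ∏ q, letterVal x (Function.update v t f) (w q) =
      algebraMap k _ (f (monElem k x d (w p).1)) *
        ∏ q ∈ Finset.univ.erase p, letterVal x v (w q) := by
  rw [← Finset.mul_prod_erase _ _ (Finset.mem_univ p)]
  congr 1
  · rw [letterVal, hp]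
    simp
  · refine Finset.prod_congr rfl fun q hq => ?_
    rw [letterVal, letterVal]
    cases ho : (w q).2 with
    | none => rfl
    | some s =>
      have hs : s ≠ t := by
        rintro rfl
        exact (Finset.mem_erase.1 hq).1 ((hw.marker s).unique ho hp)
      simp [Function.update_of_ne hs]

/-- Permutation of the markers of a letter. -/
def relabel (τ : Equiv.Perm (Fin i)) (l : Letter N i) : Letter N i := (l.1, l.2.map τ)

theorem letterVal_relabel (v : Fin i → Module.Dual k (monPart k x d)) (τ : Equiv.Perm (Fin i))
    (l : Letter N i) : letterVal x v (relabel τ l) = letterVal x (v ∘ τ) l := by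
  rcases l with ⟨a, _ | t⟩ <;> rfl

/-- The action of permutations of the positions and of the markers on words. -/
def permWord (σ : Equiv.Perm (Fin n)) (τ : Equiv.Perm (Fin i)) (w : Fin n → Letter N i) :
    Fin n → Letter N i := fun p => relabel τ (w (σ p))

theorem wordVal_permWord (v : Fin i → Module.Dual k (monPart k x d)) (σ : Equiv.Perm (Fin n))
    (τ : Equiv.Perm (Fin i)) (z : (Fin n → Letter N i) →₀ k) :
    wordVal x v (z.mapDomain (permWord σ τ)) = wordVal x (v ∘ τ) z := by
  rw [wordVal, Finsupp.linearCombination_mapDomain]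
  refine linearCombination_congr fun w _ => ?_
  simp only [Function.comp_apply, permWord, letterVal_relabel]
  exact Equiv.prod_comp σ fun p => letterVal x (v ∘ τ) (w p)

theorem wordVal_insertWord (v : Fin i → Module.Dual k (monPart k x d)) (p : Fin (n + 1))
    (a : Fin N → ℕ) (z : (Fin n → Letter N i) →₀ k) :
    wordVal x v (z.mapDomain (insertWord p a)) =
      SymmetricAlgebra.ι k _ (monElem k x d a) * wordVal x v z := by
  rw [wordVal, Finsupp.linearCombination_mapDomain, wordVal, ← linearCombination_const_mul]
  refine linearCombination_congr fun w _ => ?_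
  rw [Function.comp_apply, Fin.prod_univ_succAbove _ p]
  simp [insertWord, letterVal]

/-- The linear combinations of marked words with letters of degree `d` that change sign under
transpositions of markers. -/
noncomputable def alternatingWords (k : Type*) [Field k] (N i d n : ℕ) :
    Submodule k ((Fin n → Letter N i) →₀ k) :=
  Finsupp.supported k k {w | IsMarkedWord d n w} ⊓
    ⨅ (s : Fin i) (t : Fin i) (_ : s ≠ t),
      LinearMap.ker (Finsupp.lmapDomain k k (permWord 1 (Equiv.swap s t)) + LinearMap.id)

theorem mem_alternatingWords {z : (Fin n → Letter N i) →₀ k} :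
    z ∈ alternatingWords k N i d n ↔ (∀ w ∈ z.support, IsMarkedWord d n w) ∧
      ∀ s t, s ≠ t → z.mapDomain (permWord 1 (Equiv.swap s t)) = - z := by
  simp only [alternatingWords, Submodule.mem_inf, Submodule.mem_iInf, LinearMap.mem_ker,
    LinearMap.add_apply, Finsupp.lmapDomain_apply, LinearMap.id_apply, add_eq_zero_iff_eq_neg]
  exact Iff.rfl

/-- The alternating map defined by an alternating linear combination of words. -/
noncomputable def wordAlt [CharZero k] {z : (Fin n → Letter N i) →₀ k}
    (hz : z ∈ alternatingWords k N i d n) :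
    Module.Dual k (monPart k x d) [⋀^Fin i]→ₗ[k] SymmetricAlgebra k (monPart k x d) where
  toFun v := wordVal x v z
  map_update_add' := by
    intro _ v t f g
    have hz := (mem_alternatingWords.1 hz).1
    simp only [wordVal, Finsupp.linearCombination_apply]
    rw [← Finsupp.sum_add]
    refine Finsupp.sum_congr fun w hw => ?_
    obtain ⟨p, hp, -⟩ := (hz w hw).marker t
    simp only [prod_letterVal_update x v t _ (hz w hw) hp, LinearMap.add_apply, map_add, add_mul,
      smul_add]
  map_update_smul' := by
    intro _ v t c f
    have hz := (mem_alternatingWords.1 hz).1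
    simp only [wordVal, Finsupp.linearCombination_apply]
    rw [Finsupp.smul_sum]
    refine Finsupp.sum_congr fun w hw => ?_
    obtain ⟨p, hp, -⟩ := (hz w hw).marker t
    simp only [prod_letterVal_update x v t _ (hz w hw) hp, LinearMap.smul_apply, smul_eq_mul,
      map_mul]
    rw [smul_comm c, mul_assoc, ← Algebra.smul_def c]
  map_eq_zero_of_eq' := by
    intro v s t hst hne
    have h : wordVal x v z = - wordVal x v z := by
      rw [← map_neg, ← (mem_alternatingWords.1 hz).2 s t hne, wordVal_permWord]
      congr 2
      funext q
      rw [Function.comp_apply]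
      rcases eq_or_ne q s with rfl | hs
      · rw [Equiv.swap_apply_left, hst]
      rcases eq_or_ne q t with rfl | ht
      · rw [Equiv.swap_apply_right, hst]
      · rw [Equiv.swap_apply_of_ne_of_ne hs ht]
    have h2 : (2 : k) • wordVal x v z = 0 := by
      rw [two_smul]
      exact add_eq_zero_iff_eq_neg.2 h
    exact (smul_eq_zero.1 h2).resolve_left two_ne_zero

/-- The value of a letter after the marker `0` has been removed. -/
noncomputable def contractVal (v : Fin i → Module.Dual k (monPart k x d)) (l : Letter N (i + 1)) :
    SymmetricAlgebra k (monPart k x d) :=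
  match l.2 with
  | none => SymmetricAlgebra.ι k _ (monElem k x d l.1)
  | some t => Fin.cases (motive := fun _ => SymmetricAlgebra k (monPart k x d))
      (SymmetricAlgebra.ι k _ (monElem k x d l.1))
      (fun t => algebraMap k _ (v t (monElem k x d l.1))) t

/-- The Koszul differential at the level of words removes the marker `0`. -/
theorem sum_ι_mul_wordVal {κ : Type*} [Fintype κ] (b : Module.Basis κ k (monPart k x d))
    (v : Fin i → Module.Dual k (monPart k x d)) {z : (Fin n → Letter N (i + 1)) →₀ k}
    (hz : ∀ w ∈ z.support, IsMarkedWord d n w) :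
    ∑ c, SymmetricAlgebra.ι k _ (b c) * wordVal x (Matrix.vecCons (b.coord c) v) z =
      Finsupp.linearCombination k (fun w => ∏ p, contractVal x v (w p)) z := by
  simp only [wordVal, Finsupp.linearCombination_apply, Finsupp.sum, Finset.mul_sum]
  rw [Finset.sum_comm]
  refine Finset.sum_congr rfl fun w hw => ?_
  obtain ⟨p, hp, -⟩ := (hz w hw).marker 0
  rw [← Finset.mul_prod_erase _ _ (Finset.mem_univ p)]
  have h1 : contractVal x v (w p) = ∑ c, SymmetricAlgebra.ι k _ (b c) *
      letterVal x (Matrix.vecCons (b.coord c) v) (w p) := by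
    simp only [letterVal, contractVal, hp, Fin.cases_zero, Matrix.cons_val_zero]
    conv_lhs => rw [← b.sum_repr (monElem k x d (w p).1), map_sum]
    refine Finset.sum_congr rfl fun c _ => ?_
    rw [map_smul, Algebra.smul_def, mul_comm, Module.Basis.coord_apply]
  have h2 : ∀ c, ∏ q ∈ Finset.univ.erase p, letterVal x (Matrix.vecCons (b.coord c) v) (w q) =
      ∏ q ∈ Finset.univ.erase p, contractVal x v (w q) := by
    intro c
    refine Finset.prod_congr rfl fun q hq => ?_
    rw [letterVal, contractVal]
    cases ho : (w q).2 with
    | none => rfl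
    | some s =>
      refine Fin.cases (fun ho => ?_) (fun s _ => ?_) s ho
      · exact absurd (((hz w hw).marker 0).unique ho hp) (Finset.mem_erase.1 hq).1
      · simp
  rw [h1, Finset.sum_mul, Finset.smul_sum]
  refine Finset.sum_congr rfl fun c _ => ?_
  rw [← Finset.mul_prod_erase _ _ (Finset.mem_univ p), h2, mul_smul_comm, mul_assoc]

variable {Q : Type*} [CommRing Q] [Algebra k Q] (β : Fin r → B →ₐ[k] Q)

/-- The weight of a letter at a position that carries a functional `f` on `B` and a color: either
one of the markers `t + 1`, or one of the factors of the secant variety. The marker `0` is the one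
that the Koszul differential removes, so a letter marked by `0` counts as unmarked. -/
noncomputable def colorWeight (c : Fin i ⊕ Fin r) (f : Module.Dual k B) (l : Letter N (i + 1)) :
    Q :=
  match c with
  | Sum.inl t => if l.2 = some t.succ then algebraMap k Q (f (mon x l.1)) else 0
  | Sum.inr j => if l.2 = none ∨ l.2 = some 0 then β j (mon x l.1) else 0

/-- The value in `Q` of a linear combination of words for a coloring of the positions. -/
noncomputable def colorVal (c : Fin n → Fin i ⊕ Fin r) (f : Fin n → Module.Dual k B) :
    ((Fin n → Letter N (i + 1)) →₀ k) →ₗ[k] Q :=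
  Finsupp.linearCombination k fun w => ∏ p, colorWeight x β (c p) (f p) (w p)

theorem colorVal_shiftWord (c : Fin n → Fin i ⊕ Fin r) (f : Fin n → Module.Dual k B)
    (a : Fin n → Fin N → ℕ) (z : (Fin n → Letter N (i + 1)) →₀ k) :
    colorVal x β c f (z.mapDomain (shiftWord a)) =
      (∏ p, Sum.elim (fun _ => 1) (fun j => β j (mon x (a p))) (c p)) *
        colorVal x β c (fun p => f p ∘ₗ LinearMap.mulLeft k (mon x (a p))) z := by
  rw [colorVal, Finsupp.linearCombination_mapDomain, colorVal, ← linearCombination_const_mul]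
  refine linearCombination_congr fun w _ => ?_
  rw [Function.comp_apply, ← Finset.prod_mul_distrib]
  refine Finset.prod_congr rfl fun p _ => ?_
  cases c p with
  | inl t => simp [colorWeight, shiftWord, mon_add, mul_comm]
  | inr j =>
    simp only [colorWeight, shiftWord, mon_add, Sum.elim_inr, map_mul, mul_ite, mul_zero]
    rw [mul_comm]

theorem colorVal_insertWord (c : Fin (n + 1) → Fin i ⊕ Fin r) (f : Fin (n + 1) → Module.Dual k B)
    (p : Fin (n + 1)) (a : Fin N → ℕ) (z : (Fin n → Letter N (i + 1)) →₀ k) :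
    colorVal x β c f (z.mapDomain (insertWord p a)) =
      colorWeight x β (c p) (f p) (a, none) *
        colorVal x β (c ∘ p.succAbove) (f ∘ p.succAbove) z := by
  rw [colorVal, Finsupp.linearCombination_mapDomain, colorVal, ← linearCombination_const_mul]
  refine linearCombination_congr fun w _ => ?_
  rw [Function.comp_apply, Fin.prod_univ_succAbove _ p]
  simp [insertWord]

/-- The lifts to words of the cycles of the Koszul complex: the alternating combinations of words
on which all colorings vanish. The functionals range over the dual of `B`, not of its part of
degree `d`, which makes the conditions for different degrees comparable. -/
noncomputable def cycleWords (d n : ℕ) : Submodule k ((Fin n → Letter N (i + 1)) →₀ k) :=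
  alternatingWords k N (i + 1) d n ⊓
    ⨅ (c : Fin n → Fin i ⊕ Fin r) (f : Fin n → Module.Dual k B),
      LinearMap.ker (colorVal x β c f)

theorem mem_cycleWords {z : (Fin n → Letter N (i + 1)) →₀ k} :
    z ∈ cycleWords x β d n ↔ z ∈ alternatingWords k N (i + 1) d n ∧
      ∀ c f, colorVal x β c f z = 0 := by
  simp only [cycleWords, Submodule.mem_inf, Submodule.mem_iInf, LinearMap.mem_ker]

theorem isWordFamily_cycleWords : IsWordFamily fun d n => cycleWords (k := k) (i := i) x β d n where
  marked hz hw := (mem_alternatingWords.1 ((mem_cycleWords x β).1 hz).1).1 _ hw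
  shift {d n e z} a ha hz := by
    classical
    obtain ⟨hz, hc⟩ := (mem_cycleWords x β).1 hz
    obtain ⟨hm, hs⟩ := mem_alternatingWords.1 hz
    refine (mem_cycleWords x β).2 ⟨mem_alternatingWords.2 ⟨fun w hw => ?_, fun s t hst => ?_⟩,
      fun c f => ?_⟩
    · obtain ⟨w, hwz, rfl⟩ := Finset.mem_image.1 (Finsupp.mapDomain_support hw)
      refine ⟨fun p => ?_, (hm w hwz).marker⟩
      simp [shiftWord, Finset.sum_add_distrib, ha, (hm w hwz).degree]
    · rw [← Finsupp.mapDomain_comp, ← mapDomain_neg, ← hs s t hst, ← Finsupp.mapDomain_comp]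
      rfl
    · rw [colorVal_shiftWord, hc, mul_zero]
  insert {d n z} p a ha hz := by
    classical
    obtain ⟨hz, hc⟩ := (mem_cycleWords x β).1 hz
    obtain ⟨hm, hs⟩ := mem_alternatingWords.1 hz
    refine (mem_cycleWords x β).2 ⟨mem_alternatingWords.2 ⟨fun w hw => ?_, fun s t hst => ?_⟩,
      fun c f => ?_⟩
    · obtain ⟨w, hwz, rfl⟩ := Finset.mem_image.1 (Finsupp.mapDomain_support hw)
      refine ⟨fun q => ?_, fun l => ?_⟩
      · rcases Fin.eq_self_or_eq_succAbove p q with rfl | ⟨q, rfl⟩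
        · simp [insertWord, ha]
        · simp [insertWord, (hm w hwz).degree]
      · obtain ⟨q, hq, huniq⟩ := (hm w hwz).marker l
        refine ⟨p.succAbove q, by simpa [insertWord] using hq, fun q' hq' => ?_⟩
        rcases Fin.eq_self_or_eq_succAbove p q' with rfl | ⟨q', rfl⟩
        · simp [insertWord] at hq'
        · rw [huniq q' (by simpa [insertWord] using hq')]
    · rw [← Finsupp.mapDomain_comp, ← mapDomain_neg, ← hs s t hst, ← Finsupp.mapDomain_comp]
      congr 1
      funext w q
      rcases Fin.eq_self_or_eq_succAbove p q with rfl | ⟨q, rfl⟩ <;>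
        simp [insertWord, permWord, relabel]
    · rw [colorVal_insertWord, hc, mul_zero]

end Evaluation

/-! ### Cycles and colorings -/

section Coloring

variable {k : Type*} [Field k] {B : Type*} [CommRing B] [Algebra k B] {N : ℕ} (x : Fin N → B)
  {i r d n : ℕ} {Q : Type*} [CommRing Q] [Algebra k Q] (β : Fin r → B →ₐ[k] Q)

/-- The exponent of the monomial that records the colors of the second kind in a coloring. -/
noncomputable def colorExponent (c : Fin n → Fin i ⊕ Fin r) : Fin r →₀ ℕ :=
  ∑ p, Sum.elim (fun _ => 0) (fun j => Finsupp.single j 1) (c p)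

theorem colorExponent_apply (c : Fin n → Fin i ⊕ Fin r) (j : Fin r) :
    colorExponent c j = Fintype.card {p // c p = Sum.inr j} := by
  classical
  rw [colorExponent, Finsupp.finsetSum_apply, Fintype.card_subtype, Finset.card_filter]
  refine Finset.sum_congr rfl fun p _ => ?_
  cases c p with
  | inl t => simp
  | inr j' => simp [Finsupp.single_apply]

theorem monomial_linearCombination {α σ : Type*} (e : σ →₀ ℕ) (g : α → Q) (z : α →₀ k) :
    MvPolynomial.monomial e (Finsupp.linearCombination k g z) =
      Finsupp.linearCombination k (fun w => MvPolynomial.monomial e (g w)) z := by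
  rw [Finsupp.linearCombination_apply, Finsupp.linearCombination_apply, map_finsuppSum]
  exact Finsupp.sum_congr fun w _ => by rw [MvPolynomial.smul_monomial]

theorem linearCombination_finset_sum {α γ A : Type*} [AddCommGroup A] [Module k A] (s : Finset γ)
    (g : α → γ → A) (z : α →₀ k) :
    Finsupp.linearCombination k (fun w => ∑ c ∈ s, g w c) z =
      ∑ c ∈ s, Finsupp.linearCombination k (fun w => g w c) z := by
  simp only [Finsupp.linearCombination_apply, Finsupp.sum, Finset.smul_sum]
  exact Finset.sum_comm

theorem colorHom_contractVal (v : Fin i → Module.Dual k (monPart k x d))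
    (f : Fin i ⊕ Fin r → Module.Dual k B)
    (hf : ∀ t, v t = f (Sum.inl t) ∘ₗ (monPart k x d).subtype) (l : Letter N (i + 1))
    (hl : ∑ t, l.1 t = d) :
    colorHom β (monPart k x d) (contractVal x v l) =
      ∑ c, MvPolynomial.C (colorWeight x β c (f c) l) *
        MvPolynomial.monomial (Sum.elim (fun _ => 0) (fun j => Finsupp.single j 1) c) 1 := by
  rw [Fintype.sum_sum_type]
  have hι : ∑ j, MvPolynomial.X j * MvPolynomial.C (β j (mon x l.1)) =
      ∑ j, MvPolynomial.C (β j (mon x l.1)) * MvPolynomial.monomial (Finsupp.single j 1) 1 :=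
    Finset.sum_congr rfl fun j _ => mul_comm _ _
  rcases l with ⟨a, _ | t⟩
  · simp only [contractVal, colorWeight, colorHom_ι, coe_monElem x hl, hι]
    simp
  · refine Fin.cases ?_ (fun t => ?_) t
    · simp only [contractVal, colorWeight, Fin.cases_zero, colorHom_ι, coe_monElem x hl, hι]
      simp [(Fin.succ_ne_zero _).symm]
    · simp only [contractVal, colorWeight, Fin.cases_succ, AlgHom.commutes, hf,
        LinearMap.comp_apply, Submodule.subtype_apply, coe_monElem x hl]
      rw [Finset.sum_eq_single t]
      · rw [if_pos rfl, IsScalarTower.algebraMap_apply k Q (MvPolynomial (Fin r) Q),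
          MvPolynomial.algebraMap_eq]
        simp
      · intro s _ hs
        simp [Ne.symm hs]
      · simp

/-- The value in `Q[X]` of a contracted combination of words collects its values for all
colorings. -/
theorem colorHom_contract (v : Fin i → Module.Dual k (monPart k x d))
    (f : Fin i ⊕ Fin r → Module.Dual k B)
    (hf : ∀ t, v t = f (Sum.inl t) ∘ₗ (monPart k x d).subtype)
    (z : (Fin n → Letter N (i + 1)) →₀ k) (hz : ∀ w ∈ z.support, IsMarkedWord d n w) :
    colorHom β (monPart k x d)
        (Finsupp.linearCombination k (fun w => ∏ p, contractVal x v (w p)) z) =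
      ∑ c : Fin n → Fin i ⊕ Fin r,
        MvPolynomial.monomial (colorExponent c) (colorVal x β c (f ∘ c) z) := by
  classical
  have h1 := map_linearCombination (colorHom β (monPart k x d)).toLinearMap
    (fun w : Fin n → Letter N (i + 1) => ∏ p, contractVal x v (w p)) z
  have h2 : ∀ w ∈ z.support, (colorHom β (monPart k x d)).toLinearMap
      (∏ p, contractVal x v (w p)) = ∑ c : Fin n → Fin i ⊕ Fin r,
        MvPolynomial.monomial (colorExponent c)
          (∏ p, colorWeight x β (c p) ((f ∘ c) p) (w p)) := by
    intro w hw
    rw [AlgHom.toLinearMap_apply, map_prod]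
    simp only [colorHom_contractVal x β v f hf _ ((hz w hw).degree _)]
    rw [Finset.prod_univ_sum, Fintype.piFinset_univ]
    refine Finset.sum_congr rfl fun c _ => ?_
    rw [Finset.prod_mul_distrib, ← map_prod, colorExponent, MvPolynomial.monomial_sum_index]
    rfl
  rw [linearCombination_congr h2] at h1
  refine h1.trans ?_
  rw [linearCombination_finset_sum]
  refine Finset.sum_congr rfl fun c _ => ?_
  exact (monomial_linearCombination _ _ _).symm

theorem exists_perm_comp_eq {α κ : Type*} [Fintype α] [DecidableEq κ] (c c' : α → κ)
    (h : ∀ y, Fintype.card {p // c p = y} = Fintype.card {p // c' p = y}) :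
    ∃ σ : Equiv.Perm α, c' ∘ σ = c := by
  have e := fun y => (Fintype.card_eq.1 (h y)).some
  refine ⟨(Equiv.sigmaFiberEquiv c).symm.trans
    ((Equiv.sigmaCongrRight e).trans (Equiv.sigmaFiberEquiv c')), ?_⟩
  funext p
  exact (e (c p) ⟨p, rfl⟩).2

theorem colorVal_comp_perm (c : Fin n → Fin i ⊕ Fin r) (f : Fin n → Module.Dual k B)
    (σ : Equiv.Perm (Fin n)) (z : (Fin n → Letter N (i + 1)) →₀ k)
    (hz : z.mapDomain (permWord σ 1) = z) :
    colorVal x β (c ∘ σ) (f ∘ σ) z = colorVal x β c f z := by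
  conv_lhs => rw [← hz]
  rw [colorVal, Finsupp.linearCombination_mapDomain]
  refine linearCombination_congr fun w _ => ?_
  have : ∀ l : Letter N (i + 1), relabel 1 l = l := by
    rintro ⟨a, _ | t⟩ <;> rfl
  simp only [Function.comp_apply, permWord, this]
  exact Equiv.prod_comp σ fun p => colorWeight x β (c p) (f p) (w p)

theorem colorWeight_ne_zero {c : Fin i ⊕ Fin r} {f : Module.Dual k B} {l : Letter N (i + 1)}
    (h : colorWeight x β c f l ≠ 0) (t : Fin i) : c = Sum.inl t ↔ l.2 = some t.succ := by
  cases c with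
  | inl s =>
    rw [colorWeight] at h
    split at h
    · next hs => rw [hs]; simp
    · exact absurd rfl h
  | inr j =>
    rw [colorWeight] at h
    split at h
    · next hs =>
      rcases hs with hs | hs
      · simp [hs]
      · simp [hs, (Fin.succ_ne_zero t).symm]
    · exact absurd rfl h

/-- The value of a coloring on marked words is zero unless every color of the first kind occurs
exactly once. -/
theorem colorVal_eq_zero_of_not_existsUnique (c : Fin n → Fin i ⊕ Fin r)
    (f : Fin n → Module.Dual k B) (z : (Fin n → Letter N (i + 1)) →₀ k)
    (hz : ∀ w ∈ z.support, IsMarkedWord d n w) (hc : ¬ ∀ t, ∃! p, c p = Sum.inl t) :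
    colorVal x β c f z = 0 := by
  rw [colorVal, Finsupp.linearCombination_apply, Finsupp.sum]
  refine Finset.sum_eq_zero fun w hw => ?_
  rw [show ∏ p, colorWeight x β (c p) (f p) (w p) = 0 from ?_, smul_zero]
  by_contra h
  refine hc fun t => ?_
  have h' : ∀ p, c p = Sum.inl t ↔ (w p).2 = some t.succ := fun p =>
    colorWeight_ne_zero x β (fun h0 => h (Finset.prod_eq_zero (Finset.mem_univ p) h0)) t
  simpa only [h'] using (hz w hw).marker t.succ

/-- A symmetric combination of words whose contraction vanishes on the secant variety vanishes for
every coloring: the coefficient of a monomial is a positive multiple of the value of any coloring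
of that type. -/
theorem colorVal_eq_zero [CharZero k] (z : (Fin n → Letter N (i + 1)) →₀ k)
    (hz : ∀ w ∈ z.support, IsMarkedWord d n w)
    (hsymm : ∀ σ, z.mapDomain (permWord σ 1) = z)
    (h : ∀ v : Fin i → Module.Dual k (monPart k x d), colorHom β (monPart k x d)
        (Finsupp.linearCombination k (fun w => ∏ p, contractVal x v (w p)) z) = 0)
    (c : Fin n → Fin i ⊕ Fin r) (f : Fin n → Module.Dual k B) :
    colorVal x β c f z = 0 := by
  classical
  by_cases hc : ∀ t, ∃! p, c p = Sum.inl t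
  swap
  · exact colorVal_eq_zero_of_not_existsUnique x β c f z hz hc
  choose pos hpos huniq using hc
  set f' : Fin i ⊕ Fin r → Module.Dual k B := Sum.elim (fun t => f (pos t)) 0 with hf'
  have hff' : colorVal x β c f z = colorVal x β c (f' ∘ c) z := by
    refine linearCombination_congr fun w _ => Finset.prod_congr rfl fun p _ => ?_
    rw [Function.comp_apply]
    cases hcp : c p with
    | inl t => rw [hf', Sum.elim_inl, huniq t p hcp]
    | inr j => rfl
  rw [hff']
  -- compare the coefficients of the monomial that belongs to `c`; the colorings that contribute
  -- differ from `c` by a permutation of the positions, and so have the same value by symmetry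
  have hsum := colorHom_contract x β (fun t => f' (Sum.inl t) ∘ₗ (monPart k x d).subtype) f'
    (fun _ => rfl) z hz
  rw [h] at hsum
  have hcoeff := congrArg (MvPolynomial.coeff (colorExponent c)) hsum
  rw [MvPolynomial.coeff_zero, MvPolynomial.coeff_sum] at hcoeff
  have hterm : ∀ c' : Fin n → Fin i ⊕ Fin r, MvPolynomial.coeff (colorExponent c)
      (MvPolynomial.monomial (colorExponent c') (colorVal x β c' (f' ∘ c') z)) =
      if colorExponent c' = colorExponent c ∧ ∀ t, ∃! p, c' p = Sum.inl t then
        colorVal x β c (f' ∘ c) z else 0 := by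
    intro c'
    rw [MvPolynomial.coeff_monomial]
    by_cases hE : colorExponent c' = colorExponent c
    · by_cases hv : ∀ t, ∃! p, c' p = Sum.inl t
      · rw [if_pos hE, if_pos ⟨hE, hv⟩]
        obtain ⟨σ, rfl⟩ := exists_perm_comp_eq c' c fun y => by
          cases y with
          | inl t =>
            have h1 : Fintype.card {p // c' p = Sum.inl t} = 1 :=
              Fintype.card_eq_one_iff.2 (by
                obtain ⟨p, hp, hu⟩ := hv t
                exact ⟨⟨p, hp⟩, fun q => Subtype.ext (hu _ q.2)⟩)
            have h2 : Fintype.card {p // c p = Sum.inl t} = 1 :=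
              Fintype.card_eq_one_iff.2
                ⟨⟨pos t, hpos t⟩, fun q => Subtype.ext (huniq t _ q.2)⟩
            rw [h1, h2]
          | inr j => rw [← colorExponent_apply, ← colorExponent_apply, hE]
        exact colorVal_comp_perm x β c (f' ∘ c) σ z (hsymm σ)
      · rw [if_pos hE, if_neg fun hh => hv hh.2]
        exact colorVal_eq_zero_of_not_existsUnique x β c' _ z hz hv
    · rw [if_neg hE, if_neg fun hh => hE hh.1]
  simp only [hterm] at hcoeff
  rw [← Finset.sum_filter, Finset.sum_const, ← Nat.cast_smul_eq_nsmul k] at hcoeff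
  refine (smul_eq_zero.1 hcoeff.symm).resolve_left
    (Nat.cast_ne_zero.2 (Finset.card_pos.2 ⟨c, ?_⟩).ne')
  exact Finset.mem_filter.2 ⟨Finset.mem_univ _, rfl, fun t => ⟨pos t, hpos t, huniq t⟩⟩

variable {κ : Type*} [Fintype κ] (b : Module.Basis κ k (monPart k x d))
  (J : Ideal (SymmetricAlgebra k (monPart k x d)))

theorem symKoszul_mkQ_apply
    (y : Module.Dual k (monPart k x d) [⋀^Fin (i + 1)]→ₗ[k]
      (SymmetricAlgebra k (monPart k x d) ⧸ J))
    {z : (Fin n → Letter N (i + 1)) →₀ k} (hz : ∀ w ∈ z.support, IsMarkedWord d n w)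
    (hy : ∀ v, y v = Ideal.Quotient.mk J (wordVal x v z))
    (v : Fin i → Module.Dual k (monPart k x d)) :
    symKoszul b y v = Ideal.Quotient.mk J
      (Finsupp.linearCombination k (fun w => ∏ p, contractVal x v (w p)) z) := by
  rw [← sum_ι_mul_wordVal x b v hz, map_sum, symKoszul, koszul_apply]
  refine Finset.sum_congr rfl fun c _ => ?_
  rw [hy, map_mul]
  rfl

/-- The value of an element of `cycleWords` is a cycle of the Koszul complex. -/
theorem symKoszul_eq_zero_of_mem_cycleWords
    (hJ : ∀ s, s ∈ J ↔ colorHom β (monPart k x d) s = 0)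
    (y : Module.Dual k (monPart k x d) [⋀^Fin (i + 1)]→ₗ[k]
      (SymmetricAlgebra k (monPart k x d) ⧸ J))
    {z : (Fin n → Letter N (i + 1)) →₀ k} (hz : z ∈ cycleWords x β d n)
    (hy : ∀ v, y v = Ideal.Quotient.mk J (wordVal x v z)) : symKoszul b y = 0 := by
  obtain ⟨hz, hc⟩ := (mem_cycleWords x β).1 hz
  have hm := (mem_alternatingWords.1 hz).1
  ext v
  rw [symKoszul_mkQ_apply x b J y hm hy, AlternatingMap.zero_apply,
    Ideal.Quotient.eq_zero_iff_mem, hJ]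
  choose f hf using fun t => LinearMap.exists_extend (v t)
  rw [colorHom_contract x β v (Sum.elim f 0) (fun t => (hf t).symm) z hm]
  exact Finset.sum_eq_zero fun c _ => by rw [hc, map_zero]

end Coloring

/-! ### Spaces spanned by monomials -/

section Monomials

variable {k : Type*} [Field k] {B : Type*} [CommRing B] [Algebra k B] {N : ℕ} (x : Fin N → B)

theorem monPart_mul_le (d e : ℕ) : monPart k x d * monPart k x e ≤ monPart k x (d + e) := by
  rw [monPart, monPart, Submodule.span_mul_span, monPart]
  refine Submodule.span_mono ?_
  rintro _ ⟨_, ⟨a, ha, rfl⟩, _, ⟨c, hc, rfl⟩, rfl⟩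
  refine ⟨a + c, ?_, mon_add x a c⟩
  rw [Set.mem_ofPred_eq] at *
  simp [Finset.sum_add_distrib, ha, hc]

theorem map_monPart {A : Type*} [CommRing A] [Algebra k A] (φ : B →ₐ[k] A) (d : ℕ) :
    (monPart k x d).map φ.toLinearMap = monPart k (φ ∘ x) d := by
  rw [monPart, monPart, Submodule.map_span, Set.image_image]
  congr 1
  refine Set.image_congr fun a _ => ?_
  simp [mon]

theorem span_monElem (d : ℕ) :
    Submodule.span k (monElem k x d '' {a | ∑ t, a t = d}) = ⊤ := by
  refine Submodule.map_injective_of_injective (monPart k x d).injective_subtype ?_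
  rw [Submodule.map_span, Submodule.map_top, Submodule.range_subtype, Set.image_image]
  change _ = Submodule.span k _
  congr 1
  exact Set.image_congr fun a ha => coe_monElem x ha

/-- The span of the monomials of degree `d` has a finite basis of monomials. -/
theorem exists_basis_monElem {k : Type u} [Field k] {B : Type v} [CommRing B] [Algebra k B]
    (x : Fin N → B) (d : ℕ) : ∃ (κ : Type v) (_ : Fintype κ)
    (b : Module.Basis κ k (monPart k x d)) (a : κ → Fin N → ℕ),
      (∀ c, ∑ t, a c t = d) ∧ ∀ c, b c = monElem k x d (a c) := by
  have hs : ⊤ ≤ Submodule.span k (monElem k x d '' {a | ∑ t, a t = d}) := (span_monElem x d).ge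
  have hfin : (monElem k x d '' {a | ∑ t, a t = d}).Finite := by
    refine Set.Finite.image _ ((Finset.Nat.antidiagonalTuple N d).finite_toSet.subset ?_)
    intro a ha
    exact Finset.Nat.mem_antidiagonalTuple.2 ha
  have hsub := Module.Basis.ofSpan_subset hs
  have hsub' : ∀ c, Module.Basis.ofSpan hs c ∈ monElem k x d '' {a | ∑ t, a t = d} :=
    fun c => hsub ⟨c, rfl⟩
  have := hfin.to_subtype
  have : Finite ((linearIndepOn_empty k id).extend
      (Set.empty_subset (monElem k x d '' {a | ∑ t, a t = d}))) :=
    Finite.of_injective (fun c => (⟨_, Module.Basis.ofSpan_subset hs ⟨c, rfl⟩⟩ :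
      (monElem k x d '' {a | ∑ t, a t = d}))) fun c c' h =>
        (Module.Basis.ofSpan hs).injective (congrArg Subtype.val h)
  choose a ha hb using hsub'
  exact ⟨_, Fintype.ofFinite _, Module.Basis.ofSpan hs, a, ha, fun c => (hb c).symm⟩

theorem symPow_eq_monPart {V : Type*} [AddCommGroup V] [Module k V]
    (b : Module.Basis (Fin N) k V) (d : ℕ) :
    symPow k V d = monPart k (fun t => SymmetricAlgebra.ι k V (b t)) d := by
  apply le_antisymm
  · rw [symPow]
    induction d with
    | zero =>
      rw [pow_zero, Submodule.one_le]
      exact Submodule.subset_span ⟨0, by simp, by simp [mon]⟩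
    | succ d ih =>
      rw [pow_succ]
      refine le_trans (mul_le_mul' ih ?_) (monPart_mul_le _ d 1)
      rw [LinearMap.range_eq_map, ← b.span_eq, Submodule.map_span, monPart]
      refine Submodule.span_mono ?_
      rintro _ ⟨_, ⟨t, rfl⟩, rfl⟩
      refine ⟨Pi.single t 1, by simp, ?_⟩
      rw [mon, Finset.prod_eq_single t]
      · simp
      · intro s _ hs; simp [hs]
      · simp
  · rw [monPart, Submodule.span_le]
    rintro _ ⟨a, ha, rfl⟩
    have h := SetLike.prod_mem_graded (symPow k V) a
      (fun t => SymmetricAlgebra.ι k V (b t) ^ a t) (F := Finset.univ) fun t _ => by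
        have := SetLike.pow_mem_graded (A := symPow k V) (a t) (ι_mem_symPow k V (b t))
        rwa [smul_eq_mul, mul_one] at this
    rw [Set.mem_ofPred_eq] at ha
    rwa [ha] at h

theorem symPow_le_span (d m : ℕ) : symPow k (monPart k x d) m ≤ Submodule.span k
    {s | ∃ a : Fin m → Fin N → ℕ, (∀ q, ∑ t, a q t = d) ∧
      s = ∏ q, SymmetricAlgebra.ι k _ (monElem k x d (a q))} := by
  rw [symPow]
  induction m with
  | zero =>
    rw [pow_zero, Submodule.one_le]
    exact Submodule.subset_span ⟨fun q => q.elim0, fun q => q.elim0, by simp⟩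
  | succ m ih =>
    rw [pow_succ, LinearMap.range_eq_map, ← span_monElem x d, Submodule.map_span]
    rw [LinearMap.range_eq_map, ← span_monElem x d, Submodule.map_span] at ih
    refine le_trans (mul_le_mul' ih le_rfl) ?_
    rw [Submodule.span_mul_span]
    refine Submodule.span_mono ?_
    rintro _ ⟨_, ⟨a, ha, rfl⟩, _, ⟨_, ⟨c, hc, rfl⟩, rfl⟩, rfl⟩
    refine ⟨Fin.snoc a c, fun q => ?_, ?_⟩
    · refine Fin.lastCases ?_ (fun q => ?_) q
      · simpa using hc
      · simpa using ha q
    · rw [Fin.prod_univ_castSucc]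
      simp

end Monomials

/-! ### Lifting elements of the Koszul complex to words -/

section Lift

variable {k : Type*} [Field k] {B : Type*} [CommRing B] [Algebra k B] {N : ℕ} (x : Fin N → B)
  {i d n : ℕ} (J : Ideal (SymmetricAlgebra k (monPart k x d)))

theorem isMarkedWord_append {m : ℕ} (a : Fin i → Fin N → ℕ) (ha : ∀ l, ∑ t, a l t = d)
    (c : Fin m → Fin N → ℕ) (hc : ∀ q, ∑ t, c q t = d) :
    IsMarkedWord (N := N) (i := i) d (i + m)
      (Fin.append (fun l => (a l, some l)) fun q => (c q, none)) := by
  refine ⟨fun p => ?_, fun l => ⟨Fin.castAdd m l, by simp, fun p => ?_⟩⟩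
  · refine Fin.addCases (fun l => ?_) (fun q => ?_) p
    · simpa using ha l
    · simpa using hc q
  · refine Fin.addCases (fun l' => ?_) (fun q => ?_) p
    · simp
    · simp

/-- Every element of the Koszul complex is the value of a combination of marked words. -/
theorem exists_wordVal_eq {m : ℕ}
    (y : Module.Dual k (monPart k x d) [⋀^Fin i]→ₗ[k] (SymmetricAlgebra k (monPart k x d) ⧸ J))
    (hy : ∀ v, y v ∈ quotientPart (symPow k (monPart k x d)) J m) (hn : n = i + m) :
    ∃ z : (Fin n → Letter N i) →₀ k, (∀ w ∈ z.support, IsMarkedWord d n w) ∧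
      ∀ v, Ideal.Quotient.mk J (wordVal x v z) = y v := by
  classical
  subst hn
  obtain ⟨κ, _, b, a, ha, hb⟩ := exists_basis_monElem (k := k) x d
  let Φ : ((Fin (i + m) → Letter N i) →₀ k) →ₗ[k]
      ((Fin i → Module.Dual k (monPart k x d)) → SymmetricAlgebra k (monPart k x d) ⧸ J) :=
    LinearMap.pi fun v => (Ideal.Quotient.mkₐ k J).toLinearMap ∘ₗ wordVal x v
  let R := (Finsupp.supported k k {w : Fin (i + m) → Letter N i | IsMarkedWord d (i + m) w}).map Φ
  suffices h : (⇑y) ∈ R by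
    obtain ⟨z, hz, hzy⟩ := h
    exact ⟨z, fun w hw => hz hw, fun v => congrFun hzy v⟩
  -- expand `y` in coordinates; the coefficient of the values on the coordinate functionals is the
  -- product of the marked letters
  have hexp : (⇑y) = ∑ t : Fin i → κ, fun v : Fin i → Module.Dual k (monPart k x d) =>
      (∏ l, v l (b (t l))) • y fun l => b.coord (t l) := by
    funext v
    have h1 : v = fun l => ∑ c, v l (b c) • b.coord c :=
      funext fun l => (b.sum_dual_apply_smul_coord (v l)).symm
    conv_lhs => rw [h1]
    have h2 := y.toMultilinearMap.map_sum (fun (l : Fin i) (c : κ) => v l (b c) • b.coord c)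
    refine h2.trans ?_
    rw [Finset.sum_apply]
    exact Finset.sum_congr rfl fun t _ => y.toMultilinearMap.map_smul_univ _ _
  rw [hexp]
  refine Submodule.sum_mem _ fun t _ => ?_
  obtain ⟨s, hs, hsy⟩ := hy fun l => b.coord (t l)
  rw [← hsy]
  refine Submodule.span_induction (p := fun s _ => (fun v : Fin i → Module.Dual k (monPart k x d) =>
      (∏ l, v l (b (t l))) • (Ideal.Quotient.mkₐ k J).toLinearMap s) ∈ R)
    ?_ ?_ ?_ ?_ (symPow_le_span x d m hs)
  · rintro _ ⟨c, hc, rfl⟩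
    refine ⟨Finsupp.single (Fin.append (fun l => (a (t l), some l)) fun q => (c q, none)) 1,
      Finsupp.single_mem_supported _ _ (isMarkedWord_append _ (fun l => ha _) _ hc), ?_⟩
    funext v
    change Ideal.Quotient.mk J (wordVal x v _) = _ • Ideal.Quotient.mk J _
    rw [wordVal, Finsupp.linearCombination_single, one_smul, Fin.prod_univ_add]
    simp only [Fin.append_left, Fin.append_right, letterVal, ← hb]
    rw [← map_prod, ← Algebra.smul_def]
    rfl
  · convert zero_mem R using 1
    funext v
    simp
  · intro s s' _ _ hs hs'
    convert add_mem hs hs' using 1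
    funext v
    simp
  · intro c s _ hs
    convert Submodule.smul_mem R c hs using 1
    funext v
    simp [smul_comm c]

theorem mk_smul (c : k) (s : SymmetricAlgebra k (monPart k x d)) :
    Ideal.Quotient.mk J (c • s) = c • Ideal.Quotient.mk J s :=
  map_smul (Ideal.Quotient.mkₐ k J) c s

theorem permWord_permWord (σ σ' : Equiv.Perm (Fin n)) (τ τ' : Equiv.Perm (Fin i))
    (w : Fin n → Letter N i) :
    permWord σ τ (permWord σ' τ' w) = permWord (σ' * σ) (τ * τ') w := by
  funext p
  simp only [permWord, relabel, Option.map_map]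
  rfl

theorem IsMarkedWord.permWord {w : Fin n → Letter N i} (hw : IsMarkedWord d n w)
    (σ : Equiv.Perm (Fin n)) (τ : Equiv.Perm (Fin i)) : IsMarkedWord d n (permWord σ τ w) := by
  refine ⟨fun p => hw.degree _, fun l => ?_⟩
  obtain ⟨p, hp, hu⟩ := hw.marker (τ.symm l)
  refine ⟨σ.symm p, ?_, fun q hq => ?_⟩
  · simp [SecantSyzygies.permWord, relabel, hp]
  · rw [Equiv.eq_symm_apply]
    refine hu _ ?_
    simp only [SecantSyzygies.permWord, relabel, Option.map_eq_some_iff] at hq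
    obtain ⟨l', hl', rfl⟩ := hq
    rw [hl', Equiv.symm_apply_apply]

/-- A combination of marked words that represents an element of the Koszul complex can be chosen
symmetric in the positions and alternating in the markers. -/
theorem exists_symmetric_wordVal_eq [CharZero k] {m : ℕ}
    (y : Module.Dual k (monPart k x d) [⋀^Fin i]→ₗ[k] (SymmetricAlgebra k (monPart k x d) ⧸ J))
    (hy : ∀ v, y v ∈ quotientPart (symPow k (monPart k x d)) J m) (hn : n = i + m) :
    ∃ z : (Fin n → Letter N i) →₀ k, (∀ w ∈ z.support, IsMarkedWord d n w) ∧
      (∀ v, y v = Ideal.Quotient.mk J (wordVal x v z)) ∧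
      ∀ σ τ, z.mapDomain (permWord σ τ) = ((Equiv.Perm.sign τ : ℤ) : k) • z := by
  classical
  obtain ⟨z₀, hz₀, hy₀⟩ := exists_wordVal_eq x J y hy hn
  -- average over the permutations of the positions and the markers
  set G := Equiv.Perm (Fin n) × Equiv.Perm (Fin i)
  have hG : (Fintype.card G : k) ≠ 0 := Nat.cast_ne_zero.2 Fintype.card_ne_zero
  set z : (Fin n → Letter N i) →₀ k := (Fintype.card G : k)⁻¹ •
    ∑ g : G, ((Equiv.Perm.sign g.2 : ℤ) : k) • z₀.mapDomain (permWord g.1 g.2) with hz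
  have hsq : ∀ τ : Equiv.Perm (Fin i),
      ((Equiv.Perm.sign τ : ℤ) : k) * ((Equiv.Perm.sign τ : ℤ) : k) = 1 := by
    intro τ
    rcases Int.units_eq_one_or (Equiv.Perm.sign τ) with h | h <;> simp [h]
  refine ⟨z, ?_, fun v => ?_, fun σ τ => ?_⟩
  · have : z ∈ Finsupp.supported k k {w : Fin n → Letter N i | IsMarkedWord d n w} := by
      refine Submodule.smul_mem _ _ (Submodule.sum_mem _ fun g _ => Submodule.smul_mem _ _ ?_)
      intro w hw
      obtain ⟨w', hw', rfl⟩ := Finset.mem_image.1 (Finsupp.mapDomain_support hw)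
      exact (hz₀ w' hw').permWord _ _
    exact fun w hw => this hw
  · have h1 : ∀ g : G, Ideal.Quotient.mk J
        (((Equiv.Perm.sign g.2 : ℤ) : k) • wordVal x v (z₀.mapDomain (permWord g.1 g.2))) =
        y v := by
      intro g
      have h := hy₀ (v ∘ g.2)
      rw [wordVal_permWord, mk_smul, h, AlternatingMap.map_perm, Units.smul_def,
        ← Int.cast_smul_eq_zsmul k, smul_smul, hsq, one_smul]
    have h2 : wordVal x v z = (Fintype.card G : k)⁻¹ • ∑ g : G,
        ((Equiv.Perm.sign g.2 : ℤ) : k) • wordVal x v (z₀.mapDomain (permWord g.1 g.2)) := by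
      simp only [hz, map_smul, map_sum]
    rw [h2, mk_smul, map_sum, Finset.sum_congr rfl fun g _ => h1 g, Finset.sum_const,
      Finset.card_univ, ← Nat.cast_smul_eq_nsmul k, smul_smul, inv_mul_cancel₀ hG, one_smul]
  · have h1 : ∀ y : (Fin n → Letter N i) →₀ k, y.mapDomain (permWord σ τ) =
        Finsupp.lmapDomain k k (permWord σ τ) y := fun _ => rfl
    rw [h1, hz, map_smul, map_sum, smul_comm _ (Fintype.card G : k)⁻¹]
    refine congrArg _ ?_
    rw [Finset.smul_sum]
    refine Fintype.sum_equiv ((Equiv.mulRight σ).prodCongr (Equiv.mulLeft τ)) _ _ fun g => ?_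
    rw [map_smul, ← h1, ← Finsupp.mapDomain_comp]
    have h2 : permWord σ τ ∘ permWord g.1 g.2 = permWord (N := N) (g.1 * σ) (τ * g.2) :=
      funext fun w => permWord_permWord σ g.1 τ g.2 w
    rw [h2, smul_smul]
    congr 1
    simp only [Equiv.prodCongr_apply, Prod.map_snd, Equiv.coe_mulLeft, Equiv.Perm.sign_mul,
      Units.val_mul, Int.cast_mul]
    rw [← mul_assoc, hsq, one_mul]

end Lift

/-! ### Vanishing of Tor in large degrees -/

section Vanishing

variable {k : Type*} [Field k] [CharZero k] {B : Type*} [CommRing B] [Algebra k B] {N : ℕ}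
  (x : Fin N → B)

/-- The Koszul homology of the secant rings vanishes in large degree, in positive exterior
degree. -/
theorem exists_bound_koszul_succ {r : ℕ} {Q : Type*} [CommRing Q] [Algebra k Q]
    (β : Fin r → B →ₐ[k] Q) (i : ℕ) :
    ∃ C, ∀ (d : ℕ) (J : Ideal (SymmetricAlgebra k (monPart k x d))),
      (∀ s, s ∈ J ↔ colorHom β (monPart k x d) s = 0) →
      ∀ {κ : Type _} [Fintype κ] (b : Module.Basis κ k (monPart k x d)) (m : ℕ), C ≤ m →
      ∀ y : Module.Dual k (monPart k x d) [⋀^Fin (i + 1)]→ₗ[k]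
        (SymmetricAlgebra k (monPart k x d) ⧸ J),
      symKoszul b y = 0 →
      (∀ v, y v ∈ quotientPart (symPow k (monPart k x d)) J (m - (i + 1))) →
      ∃ z, symKoszul b z = y := by
  obtain ⟨C, hC⟩ := (isWordFamily_cycleWords (k := k) (i := i) x β).exists_le_span
  refine ⟨max (C + 1) (i + 1), fun d J hJ κ _ b m hm y hy hym => ?_⟩
  have hm1 : C + 1 ≤ m := (le_max_left _ _).trans hm
  have hm2 : i + 1 ≤ m := (le_max_right _ _).trans hm
  obtain ⟨n, rfl⟩ : ∃ n, m = n + 1 := ⟨m - 1, by omega⟩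
  obtain ⟨z, hz, hzy, hperm⟩ := exists_symmetric_wordVal_eq x J y hym
    (n := n + 1) (by omega)
  have hzc : z ∈ cycleWords x β d (n + 1) := by
    refine (mem_cycleWords x β).2 ⟨mem_alternatingWords.2 ⟨hz, fun s t hst => ?_⟩, ?_⟩
    · rw [hperm, Equiv.Perm.sign_swap hst]
      simp
    · refine colorVal_eq_zero x β z hz (fun σ => ?_) fun v => ?_
      · rw [hperm, Equiv.Perm.sign_one]
        simp
      · rw [← hJ, ← Ideal.Quotient.eq_zero_iff_mem, ← symKoszul_mkQ_apply x b J y hz hzy, hy]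
        rfl
  -- an insertion in a cycle is a multiple of a cycle by an element of `B_d`, hence a boundary
  have key : ∀ z' ∈ Submodule.span k {s | ∃ p a, ∃ z ∈ cycleWords (k := k) (i := i) x β d n,
      ∑ y, a y = d ∧ s = Finsupp.mapDomain (insertWord p a) z}, ∃ u : Module.Dual k (monPart k x d)
        [⋀^Fin (i + 2)]→ₗ[k] (SymmetricAlgebra k (monPart k x d) ⧸ J),
      ∀ v, symKoszul b u v = Ideal.Quotient.mk J (wordVal x v z') := by
    intro z' hz'
    induction hz' using Submodule.span_induction with
    | mem s hs =>
      obtain ⟨p, a, z₁, hz₁, -, rfl⟩ := hs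
      set y₁ : Module.Dual k (monPart k x d) [⋀^Fin (i + 1)]→ₗ[k]
          (SymmetricAlgebra k (monPart k x d) ⧸ J) :=
        ((Submodule.mkQ J).restrictScalars k).compAlternatingMap
          (wordAlt x ((mem_cycleWords x β).1 hz₁).1) with hy₁
      have hval : ∀ v, y₁ v = Ideal.Quotient.mk J (wordVal x v z₁) := fun v => rfl
      have h0 := symKoszul_eq_zero_of_mem_cycleWords x β b J hJ y₁ hz₁ hval
      refine ⟨_, fun v => (congrArg (fun f => f v) (koszul_wedge b.coord
        (fun c => SymmetricAlgebra.ι k _ (b c))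
        (Module.Dual.eval k _ (monElem k x d a)) y₁ h0)).trans ?_⟩
      have hsum : ∑ c, Module.Dual.eval k _ (monElem k x d a) (b.coord c) •
          SymmetricAlgebra.ι k _ (b c) = SymmetricAlgebra.ι k _ (monElem k x d a) := by
        have h := congrArg (SymmetricAlgebra.ι k _) (b.sum_repr (monElem k x d a))
        simp only [map_sum, map_smul] at h
        exact h
      rw [hsum, wordVal_insertWord, map_mul, LinearMap.compAlternatingMap_apply, hval]
      rfl
    | zero => exact ⟨0, fun v => by simp [koszul_apply]⟩
    | add s t _ _ hs ht =>
      obtain ⟨u, hu⟩ := hs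
      obtain ⟨u', hu'⟩ := ht
      exact ⟨u + u', fun v => by
        rw [symKoszul, koszul_add, AlternatingMap.add_apply, hu, hu', map_add, map_add]⟩
    | smul c s _ hs =>
      obtain ⟨u, hu⟩ := hs
      exact ⟨c • u, fun v => by
        rw [symKoszul, koszul_smul, AlternatingMap.smul_apply, hu, map_smul, mk_smul]⟩
  obtain ⟨u, hu⟩ := key z (hC d n (by omega) hzc)
  exact ⟨u, AlternatingMap.ext fun v => (hu v).trans (hzy v).symm⟩

/-- The Koszul homology of a quotient of `Sym(W)` vanishes in positive degree in exterior degree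
zero. -/
theorem exists_symKoszul_eq_of_pos {k : Type*} [Field k] [CharZero k] {W : Type*} [AddCommGroup W]
    [Module k W] {κ : Type*} [Fintype κ] (b : Module.Basis κ k W) (J : Ideal (SymmetricAlgebra k W))
    {m : ℕ} (hm : 0 < m) (y : Module.Dual k W [⋀^Fin 0]→ₗ[k] (SymmetricAlgebra k W ⧸ J))
    (hy : ∀ v, y v ∈ quotientPart (symPow k W) J m) : ∃ z, symKoszul b z = y := by
  obtain ⟨s, hs, hsy⟩ := hy Fin.elim0
  have hs' : s ∈ (HomogeneousIdeal.irrelevant (symPow k W)).toIdeal := by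
    refine (HomogeneousIdeal.mem_irrelevant_iff _ _).2 ?_
    rw [GradedRing.proj_apply, DirectSum.decompose_of_mem_ne _ hs hm.ne']
  obtain ⟨z, hz⟩ := exists_symKoszul_eq_of_irrelevant b
    (AlternatingMap.constOfIsEmpty k (Module.Dual k W) (Fin 0) (Finsupp.single () s)) fun v a => by
      simpa using hs'
  let φ : (Unit →₀ SymmetricAlgebra k W) →ₗ[SymmetricAlgebra k W] (SymmetricAlgebra k W ⧸ J) :=
    Submodule.mkQ J ∘ₗ Finsupp.lapply ()
  refine ⟨(φ.restrictScalars k).compAlternatingMap z, ?_⟩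
  rw [symKoszul, koszul_comp, show koszul _ _ z = _ from hz]
  ext v
  rw [Subsingleton.elim v Fin.elim0, ← hsy]
  simp [φ]

/-- The Tor modules of the secant rings of the spaces spanned by the monomials of degree `d`
vanish in large degree, uniformly in `d`. -/
theorem exists_tor_eq_bot {k : Type u} [Field k] [CharZero k] {B : Type v} [CommRing B]
    [Algebra k B] {N : ℕ} (x : Fin N → B) (i : ℕ) {r : ℕ} (hr : 1 ≤ r) :
    ∃ C, ∀ (d : ℕ) (W : Submodule k B), W = monPart k x d →
      ∀ F : GradedFreeResolution (symPow k W) (quotientPart (symPow k W) (secantIdeal W r)),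
        ∀ m, C < m → F.Tor i m = ⊥ := by
  obtain ⟨Q, _, _, β, hβ⟩ := exists_mem_secantIdeal_iff (k := k) B hr
  cases i with
  | zero =>
    refine ⟨0, ?_⟩
    rintro d _ rfl F m hm
    obtain ⟨κ, _, b, -, -, -⟩ := exists_basis_monElem (k := k) x d
    exact F.tor_eq_bot b (Nat.zero_le m) hm fun y _ hy => exists_symKoszul_eq_of_pos b _ hm y hy
  | succ i =>
    obtain ⟨C, hC⟩ := exists_bound_koszul_succ x β i
    refine ⟨max C (i + 1), ?_⟩
    rintro d _ rfl F m hm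
    obtain ⟨κ, _, b, -, -, -⟩ := exists_basis_monElem (k := k) x d
    have h1 := (le_max_left C (i + 1)).trans_lt hm
    have h2 := (le_max_right C (i + 1)).trans_lt hm
    exact F.tor_eq_bot b h2.le (by omega) fun y hy hym =>
      hC d _ (hβ _) b m h1.le y hy hym

/-- The part of degree `d` of the coordinate ring is spanned by the monomials in the linear
coordinates. -/
theorem coordPart_eq_monPart {k : Type u} [Field k] {V : Type v} [AddCommGroup V] [Module k V]
    (I : HomogeneousIdeal (symPow k V)) {N : ℕ} (b : Module.Basis (Fin N) k V) (d : ℕ) :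
    coordPart I d =
      monPart k (fun t => Ideal.Quotient.mkₐ k I.toIdeal (SymmetricAlgebra.ι k V (b t))) d := by
  rw [coordPart, quotientPart, symPow_eq_monPart b, map_monPart]
  rfl


theorem exists_tor_secPart_eq_bot {k : Type u} [Field k] [CharZero k] {V : Type v}
    [AddCommGroup V] [Module k V] [FiniteDimensional k V] (I : HomogeneousIdeal (symPow k V))
    (i : ℕ) {r : ℕ} (hr : 1 ≤ r) :
    ∃ C, ∀ (d : ℕ) (F : GradedFreeResolution (symPow k (coordPart I d)) (secPart I d r)),
        ∀ m, C < m → F.Tor i m = ⊥ := by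
  let x : Fin (Module.finrank k V) → CoordRing I := fun t =>
    Ideal.Quotient.mkₐ k I.toIdeal (SymmetricAlgebra.ι k V (Module.finBasis k V t))
  have h0 := exists_tor_eq_bot (k := k) (B := CoordRing I) x i hr
  obtain ⟨C, hC⟩ := h0
  have h1 := fun d => coordPart_eq_monPart I (Module.finBasis k V) d
  exact ⟨C, fun d => hC d _ (h1 d)⟩

end Vanishing

end SecantSyzygies

theorem mainTheorem2 {k : Type u} [Field k] [CharZero k] {V : Type v} [AddCommGroup V] [Module k V]
    [FiniteDimensional k V] (I : HomogeneousIdeal (SecantSyzygies.symPow k V)) :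
    ∃ C : ℕ → ℕ → ℕ, ∀ i r d : ℕ, 1 ≤ r →
      ∀ F : SecantSyzygies.GradedFreeResolution
          (SecantSyzygies.symPow k (SecantSyzygies.coordPart I d)) (SecantSyzygies.secPart I d r),
        ∀ m : ℕ, C i r < m → F.Tor i m = ⊥ := by
  have h : ∀ i r : ℕ, ∃ C : ℕ, 1 ≤ r → ∀ d : ℕ, ∀ F : SecantSyzygies.GradedFreeResolution
      (SecantSyzygies.symPow k (SecantSyzygies.coordPart I d)) (SecantSyzygies.secPart I d r),
        ∀ m : ℕ, C < m → F.Tor i m = ⊥ := by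
    intro i r
    by_cases hr : 1 ≤ r
    · have h0 := SecantSyzygies.exists_tor_secPart_eq_bot I i hr
      obtain ⟨C, hC⟩ := h0
      exact ⟨C, fun _ => hC⟩
    · exact ⟨0, fun h => absurd h hr⟩
  choose C hC using h
  exact ⟨C, fun i r d hr => hC i r hr d⟩
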